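/- Let $F$ be a differential field of characteristic zero with derivation $'$, let $K\supseteq F$ be a differential field extension, and for a subfield $M$ of $K$ write $C_M=\{x\in M: x'=0\}$. An element $l\in K$ is called a logarithm of a nonzero $h\in K$ if $l'=h'/h$, and an element $l\in K$ is called a dilogarithm of $g\in K\setminus\{0,1\}$ if there is $\varphi\in K$ with $\varphi'=-\frac{(1-g)'}{1-g}$ and $l'=\frac{g'}{g}\,\varphi$. Let $\theta\in K$ be transcendental over $F$ with $C_{F(\theta)}=C_F$, and suppose that $\theta'\in F$ or $\theta'/\theta\in F$. Let $t\ge 3$ and let $\alpha_1,\dots,\alpha_t\in F$ be distinct. Let $\log(\alpha_j-\alpha_k)\in K$ (for $j\ne k$) and $\log(\theta-\alpha_j)\in K$ be any logarithms of $\alpha_j-\alpha_k$ and $\theta-\alpha_j$, and assume that $$E=F(\theta)\bigl(\{\log(\alpha_j-\alpha_k): 1\le j,k\le t,\ j\neq k\}\cup\{\log(\theta-\alpha_j): 1\le j\le t\}\bigr)$$ satisfies $C_E=C_F$. For all $1\le j<k\le t$ let $\ell_2\!\left(\frac{\theta-\alpha_j}{\theta-\alpha_k}\right)\in K$ be any dilogarithm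 of $\frac{\theta-\alpha_j}{\theta-\alpha_k}$. Then the family $\left(\ell_2\!\left(\frac{\theta-\alpha_j}{\theta-\alpha_k}\right)\right)_{1\le j<k\le t}$ is algebraically independent over $E$. -/

import Mathlib

open scoped Differential IntermediateField

/-- `l` is a logarithm of the nonzero element `h` of the differential field `K`. -/
def IsLogarithm {K : Type*} [Field K] [Differential K] (l h : K) : Prop :=
  h ≠ 0 ∧ l′ = h′ / h

/-- `l` is a dilogarithm of `g ≠ 0, 1` in the differential field `K`: `l' = (g'/g) φ` for some
`φ` in `K` with `φ' = -(1 - g)'/(1 - g)`. -/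
def IsDilogarithm {K : Type*} [Field K] [Differential K] (l g : K) : Prop :=
  g ≠ 0 ∧ g ≠ 1 ∧ ∃ φ : K, φ′ = -((1 - g)′ / (1 - g)) ∧ l′ = g′ / g * φ

/-- The intermediate field `M` of `K / F` has the same constants as `F`. -/
def NoNewConstants {F K : Type*} [Field F] [Field K] [Differential K] [Algebra F K]
    (M : IntermediateField F K) : Prop :=
  ∀ x ∈ M, x′ = 0 → x ∈ (algebraMap F K).range

/-- The field `F(θ)({log(α_j - α_k), log(θ - α_j)})`, generated over `F` by `θ`, the elements
`logα j k` with `j ≠ k` and the elements `logθ j`. -/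
def logField (F : Type*) {K : Type*} [Field F] [Field K] [Algebra F K] {t : ℕ} (θ : K)
    (logα : Fin t → Fin t → K) (logθ : Fin t → K) : IntermediateField F K :=
  IntermediateField.adjoin F
    ({θ} ∪ {x | ∃ j k, j ≠ k ∧ x = logα j k} ∪ Set.range logθ)

/-! The engine is a principle of Ostrowski–Kolchin type: elements with derivatives in a differential
field are algebraically independent over it once no nontrivial constant combination of those
derivatives is a derivative in that field. It follows from a polynomial ring being differentially
simple (`IndepModDeriv.eq_top_of_stable`).

Put l_j = log(θ - α_j). As 1 - (θ - α_j)/(θ - α_k) = (α_j - α_k)/(θ - α_k), a dilogarithm has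
derivative (l_j' - l_k')(l_k - L_jk), with L_jk a logarithm of α_j - α_k. Suppose a combination of
these with constants c_jk (j < k) equals w'. When the l_j' are independent modulo derivatives, which
is a residue computation at θ = α_j, w is quadratic in the l_j with constant symmetric quadratic
part q. Comparing coefficients of l_i gives q_ij = c_ji off the diagonal; c is then both symmetric
and strictly triangular, hence zero (`dilog_coeff_comparison`).

The exception is θ exponential with some α_j = 0: log θ is then primitive over the base and has no
residue. It is moved into the base, and the residues of the remaining equation, differentiated, kill
the coefficients involving that index (`dilog_coeff_eq_zero_of_exp`). -/

/-! ### Derivations of polynomial rings and differential simplicity -/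

section MvDeriv

variable {σ k K : Type*} [Field k] [Differential k] [Field K] [Differential K]
  [Algebra k K] [DifferentialAlgebra k K]

/-- Differentiate every coefficient of a polynomial. -/
noncomputable def mvMapCoeff (p : MvPolynomial σ k) : MvPolynomial σ k :=
  ∑ m ∈ p.support, MvPolynomial.monomial m (p.coeff m)′

theorem coeff_mvMapCoeff (p : MvPolynomial σ k) (m : σ →₀ ℕ) :
    (mvMapCoeff p).coeff m = (p.coeff m)′ := by
  classical
  simp only [mvMapCoeff, MvPolynomial.coeff_sum, MvPolynomial.coeff_monomial, Finset.sum_ite_eq',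
    MvPolynomial.mem_support_iff, ite_not]
  split_ifs with h <;> simp [h]

theorem mvMapCoeff_mul_X (p : MvPolynomial σ k) (i : σ) :
    mvMapCoeff (p * MvPolynomial.X i) = mvMapCoeff p * MvPolynomial.X i := by
  classical
  ext m
  simp only [coeff_mvMapCoeff, MvPolynomial.coeff_mul_X']
  split_ifs <;> simp

variable [Fintype σ]

/-- The derivation of `k[X_i]` extending the derivation of `k` with `X_i ↦ a i`. -/
noncomputable def mvDeriv (a : σ → k) (p : MvPolynomial σ k) : MvPolynomial σ k :=
  mvMapCoeff p + ∑ i, MvPolynomial.C (a i) * MvPolynomial.pderiv i p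

theorem coeff_mvDeriv (a : σ → k) (p : MvPolynomial σ k) (m : σ →₀ ℕ) :
    (mvDeriv a p).coeff m =
      (p.coeff m)′ + ∑ i, a i * (p.coeff (m + Finsupp.single i 1) * (m i + 1)) := by
  unfold mvDeriv
  rw [MvPolynomial.coeff_add, MvPolynomial.coeff_sum, coeff_mvMapCoeff]
  congr 1
  refine Finset.sum_congr rfl fun i _ => ?_
  rw [MvPolynomial.coeff_C_mul, MvPolynomial.coeff_pderiv]

theorem mvDeriv_add (a : σ → k) (p q : MvPolynomial σ k) :
    mvDeriv a (p + q) = mvDeriv a p + mvDeriv a q := by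
  ext m
  simp only [coeff_mvDeriv, MvPolynomial.coeff_add, map_add, mul_add, add_mul,
    Finset.sum_add_distrib]
  ring

theorem mvDeriv_C_mul (a : σ → k) (c : k) (p : MvPolynomial σ k) :
    mvDeriv a (MvPolynomial.C c * p) =
      MvPolynomial.C c′ * p + MvPolynomial.C c * mvDeriv a p := by
  ext m
  simp only [coeff_mvDeriv, MvPolynomial.coeff_add, MvPolynomial.coeff_C_mul, Derivation.leibniz,
    smul_eq_mul, mul_add (c), Finset.mul_sum]
  rw [add_comm (c * _), add_assoc, mul_comm (c′)]
  congr 2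
  exact Finset.sum_congr rfl fun i _ => by ring

theorem mvDeriv_C (a : σ → k) (c : k) :
    mvDeriv a (MvPolynomial.C c) = MvPolynomial.C c′ := by
  have h : mvDeriv a (1 : MvPolynomial σ k) = 0 := by
    have h1 : mvMapCoeff (1 : MvPolynomial σ k) = 0 := by
      classical
      ext m
      rw [coeff_mvMapCoeff, MvPolynomial.coeff_one]
      split_ifs <;> simp
    simp [mvDeriv, h1]
  simpa [h] using mvDeriv_C_mul a c 1

theorem mvDeriv_mul_X (a : σ → k) (p : MvPolynomial σ k) (i : σ) :
    mvDeriv a (p * MvPolynomial.X i) =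
      mvDeriv a p * MvPolynomial.X i + p * MvPolynomial.C (a i) := by
  classical
  have : ∑ j, MvPolynomial.C (a j) * (MvPolynomial.pderiv j p * MvPolynomial.X i) =
      (∑ j, MvPolynomial.C (a j) * MvPolynomial.pderiv j p) * MvPolynomial.X i := by
    rw [Finset.sum_mul]
    exact Finset.sum_congr rfl fun j _ => by ring
  have hX : ∑ j, MvPolynomial.C (a j) * (p * MvPolynomial.pderiv j (MvPolynomial.X i)) =
      p * MvPolynomial.C (a i) := by
    rw [Finset.sum_eq_single i]
    · simp [mul_comm]
    · intro j _ hj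
      simp [MvPolynomial.pderiv_X_of_ne hj.symm]
    · simp
  simp only [mvDeriv, mvMapCoeff_mul_X, MvPolynomial.pderiv_mul, mul_add,
    Finset.sum_add_distrib, this, hX, add_mul]
  ring

theorem mvDeriv_mul (a : σ → k) (p q : MvPolynomial σ k) :
    mvDeriv a (p * q) = mvDeriv a p * q + p * mvDeriv a q := by
  induction q using MvPolynomial.induction_on with
  | C c => rw [mul_comm, mvDeriv_C_mul, mvDeriv_C]; ring
  | add q r hq hr => rw [mul_add, mvDeriv_add, hq, hr, mvDeriv_add]; ring
  | mul_X q i hq => rw [← mul_assoc, mvDeriv_mul_X, hq, mvDeriv_mul_X]; ring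

theorem mvDeriv_X (a : σ → k) (i : σ) : mvDeriv a (MvPolynomial.X i) = MvPolynomial.C (a i) := by
  have h := mvDeriv_mul_X a 1 i
  rw [← MvPolynomial.C_1, mvDeriv_C] at h
  simpa using h

theorem deriv_aeval_mv (a : σ → k) (y : σ → K) (hy : ∀ i, (y i)′ = algebraMap k K (a i))
    (p : MvPolynomial σ k) :
    (MvPolynomial.aeval y p)′ = MvPolynomial.aeval y (mvDeriv a p) := by
  induction p using MvPolynomial.induction_on with
  | C c => simp [mvDeriv_C, deriv_algebraMap]
  | add p q hp hq => simp [mvDeriv_add, hp, hq]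
  | mul_X p i hp => simp [mvDeriv_mul, mvDeriv_X, hp, hy]; ring

/-- No nontrivial combination of the `a i` with constant coefficients is a derivative. -/
def IndepModDeriv (a : σ → k) : Prop :=
  ∀ c : σ → k, (∀ i, (c i)′ = 0) → ∀ u : k, ∑ i, c i * a i = u′ → ∀ i, c i = 0

variable [CharZero k] {a : σ → k}

/-- In top degree the coefficients of `p` are constants, since no higher terms contribute to
`mvDeriv a p`. One degree lower, the vanishing of a coefficient says that a constant combination of
the `a i` is a derivative, so the top coefficients vanish; characteristic zero removes the integer
factors. -/
theorem IndepModDeriv.coeff_eq_zero (ha : IndepModDeriv a) (p : MvPolynomial σ k) (e : ℕ)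
    (hp : ∀ m : σ →₀ ℕ, e ≤ m.degree → (mvDeriv a p).coeff m = 0) (m : σ →₀ ℕ)
    (hm : e < m.degree) : p.coeff m = 0 := by
  classical
  by_contra hne
  obtain ⟨n, hn, hmax⟩ := p.support.exists_max_image (fun m => m.degree)
    ⟨m, MvPolynomial.mem_support_iff.2 hne⟩
  have hen : e < n.degree := hm.trans_le (hmax m (MvPolynomial.mem_support_iff.2 hne))
  have hzero : ∀ l : σ →₀ ℕ, n.degree < l.degree → p.coeff l = 0 := fun l hl => by
    by_contra h
    exact absurd (hmax l (MvPolynomial.mem_support_iff.2 h)) (by omega)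
  have hconst : ∀ l : σ →₀ ℕ, l.degree = n.degree → (p.coeff l)′ = 0 := fun l hl => by
    have h := hp l (by omega)
    rw [coeff_mvDeriv, Finset.sum_eq_zero, add_zero] at h
    · exact h
    · intro i _
      rw [hzero _ (by simp [hl])]
      simp
  obtain ⟨i, hi⟩ : ∃ i, n i ≠ 0 := by
    by_contra! h
    have : n = 0 := Finsupp.ext h
    simp [this] at hen
  have hsub : n - Finsupp.single i 1 + Finsupp.single i 1 = n :=
    tsub_add_cancel_of_le (by simpa using Nat.one_le_iff_ne_zero.2 hi)
  set l := n - Finsupp.single i 1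
  have hl : l.degree + 1 = n.degree := by
    rw [← hsub]; simp
  have h := hp l (by omega)
  rw [coeff_mvDeriv] at h
  have := ha (fun j => p.coeff (l + Finsupp.single j 1) * (l j + 1))
    (fun j => by
      rw [Derivation.leibniz, hconst _ (by simp [hl])]
      simp) (- p.coeff l)
    (by
      rw [map_neg, eq_neg_iff_add_eq_zero, add_comm, ← h]
      congr 1
      exact Finset.sum_congr rfl fun j _ => mul_comm _ _) i
  simp only [hsub, mul_eq_zero] at this
  rcases this with h' | h'
  · exact MvPolynomial.mem_support_iff.1 hn h'
  · exact Nat.cast_add_one_ne_zero _ h'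

theorem IndepModDeriv.coeff_deriv_eq_zero (ha : IndepModDeriv a) (p : MvPolynomial σ k) (e : ℕ)
    (hp : ∀ m : σ →₀ ℕ, e ≤ m.degree → (mvDeriv a p).coeff m = 0) (m : σ →₀ ℕ)
    (hm : e ≤ m.degree) : (p.coeff m)′ = 0 := by
  have h := hp m hm
  rw [coeff_mvDeriv, Finset.sum_eq_zero, add_zero] at h
  · exact h
  · intro i _
    rw [ha.coeff_eq_zero p e hp _ (by simp; omega)]
    simp

/-- Once the leading coefficient is normalised to 1, the derivation strictly lowers the leading
monomial. Descent inside `J` ends at a nonzero `q` with `mvDeriv a q = 0`, which is a nonzero scalar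
by `coeff_eq_zero` with `e = 0`. -/
theorem IndepModDeriv.eq_top_of_stable (ha : IndepModDeriv a) (J : Ideal (MvPolynomial σ k))
    (hJ : ∀ p ∈ J, mvDeriv a p ∈ J) (hJ0 : J ≠ ⊥) : J = ⊤ := by
  classical
  let _ : LinearOrder σ := LinearOrder.lift' _ (Fintype.equivFin σ).injective
  let M : MonomialOrder σ := MonomialOrder.lex
  obtain ⟨p₀, hp₀, hne₀⟩ := Submodule.exists_mem_ne_zero_of_ne_bot hJ0
  have key : ∀ s : M.syn, ∀ p ∈ J, p ≠ 0 → M.toSyn (M.degree p) = s → J = ⊤ := by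
    intro s
    induction s using WellFoundedLT.induction with
    | ind s ih =>
    intro p hp hne hs
    have hlc : M.leadingCoeff p ≠ 0 := M.leadingCoeff_ne_zero_iff.2 hne
    set q := MvPolynomial.C (M.leadingCoeff p)⁻¹ * p with hq
    have hqJ : q ∈ J := J.mul_mem_left _ hp
    have hqc : ∀ m, q.coeff m = (M.leadingCoeff p)⁻¹ * p.coeff m := fun m => by
      rw [hq, MvPolynomial.coeff_C_mul]
    have hq1 : q.coeff (M.degree p) = 1 := by
      rw [hqc]; exact inv_mul_cancel₀ hlc
    have hqle : ∀ m, q.coeff m ≠ 0 → M.toSyn m ≤ M.toSyn (M.degree p) := fun m hm =>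
      M.le_degree (MvPolynomial.mem_support_iff.2 fun h => hm (by rw [hqc, h, mul_zero]))
    by_cases hD : mvDeriv a q = 0
    · have h0 := ha.coeff_eq_zero q 0 (fun m _ => by simp [hD])
      have hqC : q = MvPolynomial.C (q.coeff 0) := by
        ext m
        rw [MvPolynomial.coeff_C]
        split_ifs with h
        · rw [h]
        · exact h0 m (Nat.pos_of_ne_zero fun h' => h ((Finsupp.degree_eq_zero_iff m).1 h').symm)
      have hunit : q.coeff 0 ≠ 0 := fun h => by
        rw [hqC, h] at hq1; simp at hq1
      refine J.eq_top_of_isUnit_mem (hqC ▸ hqJ) ?_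
      exact (isUnit_iff_ne_zero.2 hunit).map MvPolynomial.C
    · refine ih _ ?_ _ (hJ q hqJ) hD rfl
      have hmem := M.degree_mem_support hD
      rw [MvPolynomial.mem_support_iff, coeff_mvDeriv] at hmem
      set n := M.degree (mvDeriv a q)
      rw [← hs]
      by_cases hn : (q.coeff n)′ = 0
      · rw [hn, zero_add] at hmem
        obtain ⟨i, _, hi⟩ := Finset.exists_ne_zero_of_sum_ne_zero hmem
        have h1 := hqle (n + Finsupp.single i 1) (fun h => hi (by simp [h]))
        refine lt_of_lt_of_le ?_ h1
        refine M.toSyn_strictMono (lt_add_of_pos_right _ ?_)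
        exact pos_iff_ne_zero.2 (by simp)
      · refine lt_of_le_of_ne (hqle n fun h => hn (by simp [h])) fun h => hn ?_
        rw [M.toSyn.injective h, hq1]
        simp
  exact key _ p₀ hp₀ hne₀ rfl

/-- The polynomial relations between the `y i` form a stable ideal without 1. -/
theorem IndepModDeriv.algebraicIndependent (ha : IndepModDeriv a) {y : σ → K}
    (hy : ∀ i, (y i)′ = algebraMap k K (a i)) : AlgebraicIndependent k y := by
  rw [algebraicIndependent_iff_ker_eq_bot]
  by_contra hne
  have h := ha.eq_top_of_stable _ (fun p hp => ?_) hne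
  · have h1 := h.ge (Submodule.mem_top (x := (1 : MvPolynomial σ k)))
    rw [RingHom.mem_ker, map_one] at h1
    exact one_ne_zero h1
  · rw [RingHom.mem_ker] at hp ⊢
    have := deriv_aeval_mv a y hy p
    simp_all

/-- The denominators of `w` form an ideal, and the linear equation for `w` makes it stable. It
contains `Q`, which is nonzero, so it contains 1. -/
theorem IndepModDeriv.exists_aeval_eq (ha : IndepModDeriv a) {y : σ → K}
    (hy : ∀ i, (y i)′ = algebraMap k K (a i)) {w : K} {P Q : MvPolynomial σ k}
    (hQ : MvPolynomial.aeval y Q ≠ 0)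
    (hw : MvPolynomial.aeval y Q * w = MvPolynomial.aeval y P) {b : k} {s : MvPolynomial σ k}
    (hD : w′ = algebraMap k K b * w + MvPolynomial.aeval y s) :
    ∃ p : MvPolynomial σ k, MvPolynomial.aeval y p = w := by
  let J : Ideal (MvPolynomial σ k) :=
    { carrier := {p | ∃ r : MvPolynomial σ k, MvPolynomial.aeval y p * w = MvPolynomial.aeval y r}
      add_mem' := by
        rintro p q ⟨r, hr⟩ ⟨t, ht⟩
        exact ⟨r + t, by simp [add_mul, hr, ht]⟩
      zero_mem' := ⟨0, by simp⟩
      smul_mem' := by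
        rintro c p ⟨r, hr⟩
        exact ⟨c * r, by simp [mul_assoc, hr]⟩ }
  have hJ : J = ⊤ := by
    refine ha.eq_top_of_stable J ?_ ?_
    · rintro p ⟨r, hr⟩
      refine ⟨mvDeriv a r - MvPolynomial.C b * r - p * s, ?_⟩
      have h := congrArg (Differential.deriv) hr
      rw [Derivation.leibniz, deriv_aeval_mv a y hy, deriv_aeval_mv a y hy, hD] at h
      simp only [map_sub, map_mul, MvPolynomial.aeval_C, ← hr, ← h, smul_eq_mul]
      ring
    · intro h
      have : Q ∈ J := ⟨P, hw⟩
      rw [h, Submodule.mem_bot] at this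
      simp [this] at hQ
  obtain ⟨r, hr⟩ : (1 : MvPolynomial σ k) ∈ J := by rw [hJ]; trivial
  exact ⟨r, by simpa using hr.symm⟩

end MvDeriv

/-! ### Differential subfields and integrals in extensions by primitives -/

section DiffSubfield

variable {K : Type*} [Field K] [Differential K]

/-- The subfield `M` is closed under the derivation. -/
def Subfield.IsDifferential (M : Subfield K) : Prop := ∀ x ∈ M, x′ ∈ M

/-- The derivation induced on a differential subfield. -/
@[reducible]
def Subfield.IsDifferential.toDifferential {M : Subfield K} (hM : M.IsDifferential) :
    Differential M :=
  ⟨Derivation.mk'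
    { toFun := fun x => ⟨(x : K)′, hM x x.2⟩
      map_add' := fun x y => Subtype.ext (by simp)
      map_smul' := fun n x => Subtype.ext (by simp) }
    fun x y => Subtype.ext (by simp)⟩

theorem Subfield.IsDifferential.differentialAlgebra {M : Subfield K} (hM : M.IsDifferential) :
    letI := hM.toDifferential
    DifferentialAlgebra M K :=
  letI := hM.toDifferential
  ⟨fun _ => rfl⟩

theorem Subfield.isDifferential_closure {S : Set K}
    (hS : ∀ x ∈ S, x′ ∈ Subfield.closure S) : (Subfield.closure S).IsDifferential := by
  intro x hx
  induction hx using Subfield.closure_induction with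
  | mem x hx => exact hS x hx
  | one => simp
  | add x y _ _ hx hy => rw [map_add]; exact add_mem hx hy
  | neg x _ hx => rw [map_neg]; exact neg_mem hx
  | inv x hx h =>
    rw [Derivation.leibniz_inv, smul_eq_mul]
    exact mul_mem (neg_mem (pow_mem (inv_mem hx) _)) h
  | mul x y hx hy hx' hy' =>
    rw [Derivation.leibniz, smul_eq_mul, smul_eq_mul]
    exact add_mem (mul_mem hx hy') (mul_mem hy hx')

variable {σ : Type*}

theorem Subfield.IsDifferential.closure_union_range {M : Subfield K} (hM : M.IsDifferential)
    {y : σ → K} (hy : ∀ i, (y i)′ ∈ M) :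
    (Subfield.closure (M ∪ Set.range y : Set K)).IsDifferential := by
  refine Subfield.isDifferential_closure ?_
  rintro x (hx | ⟨i, rfl⟩)
  · exact Subfield.subset_closure (Or.inl (hM x hx))
  · exact Subfield.subset_closure (Or.inl (hy i))

/-- No nontrivial combination of the derivatives of the `y i` with constant coefficients in `M` is
the derivative of an element of `M`. -/
def IndepModDerivIn [Fintype σ] (M : Subfield K) (y : σ → K) : Prop :=
  ∀ c : σ → K, (∀ i, c i ∈ M) → (∀ i, (c i)′ = 0) → ∀ u ∈ M, ∑ i, c i * (y i)′ = u′ →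
    ∀ i, c i = 0

theorem Subfield.exists_aeval_of_mem_closure {K : Type*} [Field K] {M : Subfield K} {y : σ → K} {w : K}
    (hw : w ∈ Subfield.closure (M ∪ Set.range y : Set K)) :
    ∃ P Q : MvPolynomial σ M, MvPolynomial.aeval y Q ≠ 0 ∧
      MvPolynomial.aeval y Q * w = MvPolynomial.aeval y P := by
  have h : w ∈ IntermediateField.adjoin M (Set.range y) := by
    refine Subfield.closure_mono (Set.union_subset_union_left _ ?_) hw
    intro x hx
    exact ⟨⟨x, hx⟩, rfl⟩
  obtain ⟨r, s, h⟩ := IntermediateField.mem_adjoin_range_iff _ _ _ |>.1 h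
  by_cases hs : MvPolynomial.aeval y s = 0
  · refine ⟨0, 1, by simp, ?_⟩
    simp [h, hs]
  · exact ⟨r, s, hs, by rw [h]; field_simp⟩

variable [Fintype σ] {M : Subfield K} {y : σ → K}

theorem IndepModDerivIn.indepModDeriv (hM : M.IsDifferential) (hy : ∀ i, (y i)′ ∈ M)
    (h : IndepModDerivIn M y) :
    letI := hM.toDifferential
    IndepModDeriv (fun i => (⟨(y i)′, hy i⟩ : M)) := by
  let _ := hM.toDifferential
  intro c hc u hu i
  refine Subtype.ext (h (fun i => c i) (fun i => (c i).2)
    (fun i => congrArg Subtype.val (hc i)) u u.2 ?_ i)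
  rw [show ((u : K))′ = ((u′ : M) : K) from rfl, ← hu]
  simp

variable [CharZero K]

theorem IndepModDerivIn.algebraicIndependent (hM : M.IsDifferential) (hy : ∀ i, (y i)′ ∈ M)
    (h : IndepModDerivIn M y) : AlgebraicIndependent M y :=
  let _ := hM.toDifferential
  have := hM.differentialAlgebra
  (h.indepModDeriv hM hy).algebraicIndependent fun _ => rfl

theorem IndepModDerivIn.exists_aeval_eq (hM : M.IsDifferential) (hy : ∀ i, (y i)′ ∈ M)
    (h : IndepModDerivIn M y) {w b : K}
    (hw : w ∈ Subfield.closure (M ∪ Set.range y : Set K)) (hb : b ∈ M) (s : MvPolynomial σ M)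
    (hD : w′ = b * w + MvPolynomial.aeval y s) :
    ∃ p : MvPolynomial σ M, MvPolynomial.aeval y p = w := by
  let _ := hM.toDifferential
  have := hM.differentialAlgebra
  obtain ⟨P, Q, hQ, hPQ⟩ := Subfield.exists_aeval_of_mem_closure hw
  exact (h.indepModDeriv hM hy).exists_aeval_eq (fun _ => rfl) hQ hPQ (b := ⟨b, hb⟩) (s := s) hD

/-- An integral of a polynomial of degree at most one in `y` is quadratic in `y`, with constant
quadratic part. -/
theorem IndepModDerivIn.exists_of_deriv_eq_linear (hM : M.IsDifferential) (hy : ∀ i, (y i)′ ∈ M)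
    (h : IndepModDerivIn M y) {w : K} (hw : w ∈ Subfield.closure (M ∪ Set.range y : Set K))
    {s : σ → K} {s₀ : K} (hs : ∀ i, s i ∈ M) (hs₀ : s₀ ∈ M)
    (hD : w′ = ∑ i, s i * y i + s₀) :
    ∃ (q : σ → σ → K) (v : σ → K) (v₀ : K), (∀ i j, q i j ∈ M) ∧ (∀ i j, (q i j)′ = 0) ∧
      (∀ i j, q i j = q j i) ∧ (∀ i, v i ∈ M) ∧ v₀ ∈ M ∧
      (∀ i, (v i)′ + ∑ j, q i j * (y j)′ = s i) ∧ v₀′ + ∑ i, v i * (y i)′ = s₀ := by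
  classical
  let _ := hM.toDifferential
  have := hM.differentialAlgebra
  set S : MvPolynomial σ M :=
    ∑ i, MvPolynomial.C ⟨s i, hs i⟩ * MvPolynomial.X i + MvPolynomial.C ⟨s₀, hs₀⟩ with hS
  have hSa : MvPolynomial.aeval y S = w′ := by
    rw [hD, hS]; simp; rfl
  obtain ⟨p, rfl⟩ := h.exists_aeval_eq hM hy hw (zero_mem M) S (by rw [hSa]; simp)
  have ha := h.indepModDeriv hM hy
  set a : σ → M := fun i => ⟨(y i)′, hy i⟩ with haa
  have hp : mvDeriv a p = S := by
    refine h.algebraicIndependent hM hy ?_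
    rw [hSa]
    exact (deriv_aeval_mv a y (fun _ => rfl) p).symm
  have hSc : ∀ m : σ →₀ ℕ, S.coeff m =
      ∑ i, (⟨s i, hs i⟩ : M) * (if Finsupp.single i 1 = m then 1 else 0) +
        if 0 = m then ⟨s₀, hs₀⟩ else 0 := fun m => by
    simp only [hS, MvPolynomial.coeff_add, MvPolynomial.coeff_sum, MvPolynomial.coeff_C_mul,
      MvPolynomial.coeff_X, MvPolynomial.coeff_C]
  have hdeg : ∀ m : σ →₀ ℕ, 2 ≤ m.degree → (mvDeriv a p).coeff m = 0 := fun m hm => by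
    rw [hp, hSc, if_neg, add_zero]
    · refine Finset.sum_eq_zero fun i _ => ?_
      rw [if_neg, mul_zero]
      rintro rfl
      simp at hm
    · rintro rfl
      simp at hm
  have h1 : ∀ i, S.coeff (Finsupp.single i 1) = ⟨s i, hs i⟩ := fun i => by
    rw [hSc, if_neg (by simp [eq_comm]), Finset.sum_eq_single i]
    · simp
    · intro j _ hj
      rw [if_neg, mul_zero]
      rw [Finsupp.single_left_inj one_ne_zero]
      exact hj
    · simp
  have h0 : S.coeff 0 = ⟨s₀, hs₀⟩ := by
    rw [hSc]; simp
  -- `q i j` is the second partial derivative of the quadratic part: the factor is 2 on the diagonal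
  -- and 1 off it.
  refine ⟨fun i j => ((p.coeff (Finsupp.single i 1 + Finsupp.single j 1) *
      ((Finsupp.single i 1 : σ →₀ ℕ) j + 1) : M) : K),
    fun i => (p.coeff (Finsupp.single i 1) : M), (p.coeff 0 : M), fun i j => ?_, fun i j => ?_,
    fun i j => ?_, fun i => Subtype.prop _, Subtype.prop _, fun i => ?_, ?_⟩
  · exact Subtype.prop _
  · have := ha.coeff_deriv_eq_zero p 2 hdeg (Finsupp.single i 1 + Finsupp.single j 1) (by simp)
    refine congrArg Subtype.val (?_ : (_ : M)′ = 0)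
    rw [Derivation.leibniz, this]
    simp
  · simp only [Finsupp.single_apply, add_comm (Finsupp.single i 1 : σ →₀ ℕ), eq_comm]
  · have := congrArg Subtype.val (h1 i)
    rw [← hp, coeff_mvDeriv] at this
    refine Eq.trans ?_ this
    rw [AddMemClass.coe_add, AddSubmonoidClass.coe_finsetSum]
    congr 1
    exact Finset.sum_congr rfl fun j _ => mul_comm _ _
  · have := congrArg Subtype.val h0
    rw [← hp, coeff_mvDeriv] at this
    refine Eq.trans ?_ this
    rw [AddMemClass.coe_add, AddSubmonoidClass.coe_finsetSum]
    congr 1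
    refine Finset.sum_congr rfl fun j _ => ?_
    simp [a, mul_comm]

/-- A nonzero solution of `w' = b w` in `M(y)` lies in `M`. -/
theorem IndepModDerivIn.mem_of_deriv_eq_mul (hM : M.IsDifferential) (hy : ∀ i, (y i)′ ∈ M)
    (h : IndepModDerivIn M y) {w b : K} (hw : w ∈ Subfield.closure (M ∪ Set.range y : Set K))
    (hw0 : w ≠ 0) (hb : b ∈ M) (hD : w′ = b * w) : w ∈ M := by
  -- Both `w` and its inverse solve linear equations, so both are polynomials in `y`; a unit of the
  -- polynomial ring is a scalar.
  obtain ⟨p, hp⟩ := h.exists_aeval_eq hM hy hw hb 0 (by simp [hD])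
  obtain ⟨q, hq⟩ := h.exists_aeval_eq hM hy (inv_mem hw) (neg_mem hb) 0 (by
    rw [Derivation.leibniz_inv, hD, smul_eq_mul]
    field_simp
    simp)
  have hpq : p * q = 1 := by
    refine h.algebraicIndependent hM hy ?_
    simp [hp, hq, hw0]
  obtain ⟨c, _, hc⟩ := MvPolynomial.isUnit_iff_eq_C_of_isReduced.1 (IsUnit.of_mul_eq_one _ hpq)
  rw [← hp, hc, MvPolynomial.aeval_C]
  exact c.2

end DiffSubfield

/-! ### Residues at θ = α -/

section Residue

open Polynomial

variable {B K : Type*} [Field B] [Field K] [Algebra B K]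

/-- The element `x` of `B(θ)` is regular at `θ = α`. -/
def RegularAt (θ : K) (α : B) (x : K) : Prop :=
  ∃ A Q : B[X], Q.eval α ≠ 0 ∧ aeval θ Q * x = aeval θ A

theorem RegularAt.add {θ : K} {α : B} {x y : K} (hx : RegularAt θ α x) (hy : RegularAt θ α y) :
    RegularAt θ α (x + y) := by
  obtain ⟨A, Q, hQ, h⟩ := hx
  obtain ⟨A', Q', hQ', h'⟩ := hy
  refine ⟨A * Q' + A' * Q, Q * Q', by simp [hQ, hQ'], ?_⟩
  simp only [map_mul, map_add, ← h, ← h']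
  ring

theorem regularAt_aeval (θ : K) (α : B) (A : B[X]) : RegularAt θ α (aeval θ A) :=
  ⟨A, 1, by simp, by simp⟩

theorem regularAt_algebraMap (θ : K) (α : B) (b : B) : RegularAt θ α (algebraMap B K b) := by
  simpa using regularAt_aeval θ α (C b)

theorem RegularAt.mul {θ : K} {α : B} {x y : K} (hx : RegularAt θ α x) (hy : RegularAt θ α y) :
    RegularAt θ α (x * y) := by
  obtain ⟨A, Q, hQ, h⟩ := hx
  obtain ⟨A', Q', hQ', h'⟩ := hy
  refine ⟨A * A', Q * Q', by simp [hQ, hQ'], ?_⟩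
  simp only [map_mul, ← h, ← h']
  ring

theorem RegularAt.sum {θ : K} {α : B} {ι : Type*} {s : Finset ι} {f : ι → K}
    (h : ∀ i ∈ s, RegularAt θ α (f i)) : RegularAt θ α (∑ i ∈ s, f i) := by
  classical
  induction s using Finset.induction_on with
  | empty => simpa using regularAt_algebraMap θ α 0
  | insert i s hi ih =>
    rw [Finset.sum_insert hi]
    exact (h i (by simp)).add (ih fun j hj => h j (by simp [hj]))

variable [Differential B] [Differential K] [DifferentialAlgebra B K] [CharZero B]

/-- Since θ - α has a derivative not vanishing at θ = α, differentiation turns a pole of order m ≥ 1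
into one of order m + 1 ≥ 2 and keeps regular elements regular. So `u′` never has a simple pole,
whereas the logarithmic term has one unless `ρ = 0`. With `m` minimal, each case is an identity
cleared of denominators and evaluated at `α`. -/
theorem residue_eq_zero {θ : K} (hθ : Transcendental B θ) {p : B[X]} (hp : θ′ = aeval θ p) {α : B}
    (hα : p.eval α ≠ α′) {u : K} (hu : ∃ P Q : B[X], Q ≠ 0 ∧ aeval θ Q * u = aeval θ P) {ρ : B}
    (h : RegularAt θ α
      (u′ - algebraMap B K ρ * ((θ - algebraMap B K α)′ / (θ - algebraMap B K α)))) : ρ = 0 := by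
  classical
  have hinj : Function.Injective (aeval θ : B[X] →ₐ[B] K) := transcendental_iff_injective.1 hθ
  set x := θ - algebraMap B K α with hx
  obtain ⟨l, hl⟩ : ∃ l : B[X], l = X - C α := ⟨_, rfl⟩
  obtain ⟨d, hd⟩ : ∃ d : B[X], d = p - C α′ := ⟨_, rfl⟩
  have hxl : aeval θ l = x := by simp [hl, hx]
  have hxd : aeval θ d = x′ := by simp [hd, hx, hp, deriv_algebraMap]
  have hlα : l.eval α = 0 := by simp [hl]
  have hdα : d.eval α ≠ 0 := by simpa [hd, sub_eq_zero] using hα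
  have hx0 : x ≠ 0 := by
    rw [← hxl, Ne, map_eq_zero_iff _ hinj, hl]; exact X_sub_C_ne_zero α
  have hex : ∃ m : ℕ, ∃ A Q : B[X], Q.eval α ≠ 0 ∧ x ^ m * aeval θ Q * u = aeval θ A := by
    obtain ⟨P, Q, hQ, hPQ⟩ := hu
    obtain ⟨R, hR, hRα⟩ := exists_eq_pow_rootMultiplicity_mul_and_not_dvd Q hQ α
    refine ⟨rootMultiplicity α Q, P, R, ?_, ?_⟩
    · rwa [dvd_iff_isRoot] at hRα
    · rw [← hPQ, ← hxl, ← map_pow, ← map_mul, hl, ← hR]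
  obtain ⟨A, Q, hQ, hA⟩ := Nat.find_spec hex
  have hmin := fun m => Nat.find_min hex (m := m)
  generalize Nat.find hex = m at hA hmin
  obtain ⟨N, R, hR, hN⟩ := h
  have hD := congrArg (Differential.deriv) hA
  have himp := Differential.deriv_aeval_eq_implicitDeriv θ p hp
  rw [Derivation.leibniz, Derivation.leibniz, himp, himp, smul_eq_mul, smul_eq_mul, smul_eq_mul,
    smul_eq_mul, Derivation.leibniz_pow, nsmul_eq_mul, smul_eq_mul] at hD
  generalize Differential.implicitDeriv p Q = DQ at hD
  generalize Differential.implicitDeriv p A = DA at hD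
  have hN' : aeval θ R * (x * u′) = aeval θ N * x + algebraMap B K ρ * aeval θ R * x′ := by
    rw [← hN]; field_simp; ring
  rcases m with _ | m
  · have : Q * Q * (N * l + C ρ * R * d) = l * R * (Q * DA - A * DQ) := by
      refine hinj ?_
      simp only [map_mul, map_add, map_sub, hxl, hxd, aeval_C]
      simp only [pow_zero, Nat.cast_zero, zero_mul, mul_zero, add_zero, one_mul] at hA hD
      linear_combination (-aeval θ Q * aeval θ Q) * hN' + x * aeval θ R * aeval θ Q * hD
        - x * aeval θ R * aeval θ DQ * hA
    have := congrArg (eval α) this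
    simpa [hlα, hQ, hR, hdα] using this
  · exfalso
    have hAα : A.eval α ≠ 0 := fun h0 => by
      obtain ⟨A', hA'⟩ := dvd_iff_isRoot.2 h0
      refine hmin m (by omega) ⟨A', Q, hQ, ?_⟩
      refine mul_left_cancel₀ hx0 ?_
      rw [← mul_assoc, ← mul_assoc, ← pow_succ', hA, hA', map_mul, ← hl, hxl]
    have : l ^ (m + 1) * (Q * Q) * (N * l + C ρ * R * d) + A * DQ * l * R +
        ((m + 1 : ℕ) : B[X]) * d * Q * R * A = DA * l * Q * R := by
      refine hinj ?_
      simp only [map_mul, map_add, map_pow, hxl, hxd, aeval_C, map_natCast]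
      simp only [Nat.add_sub_cancel] at hD
      linear_combination (-x ^ (m + 1) * aeval θ Q * aeval θ Q) * hN' +
        x * aeval θ R * aeval θ Q * hD
        - (x * aeval θ R * aeval θ DQ + ((m + 1 : ℕ) : K) * x′ * aeval θ Q * aeval θ R) * hA
    have := congrArg (eval α) this
    simp [hlα, hQ, hR, hdα, hAα] at this
    exact Nat.cast_add_one_ne_zero m this

theorem Subfield.exists_aeval_of_mem_closure_singleton {K : Type*} [Field K] {M : Subfield K}
    {θ u : K} (hu : u ∈ Subfield.closure (M ∪ {θ} : Set K)) :
    ∃ P Q : M[X], Q ≠ 0 ∧ aeval θ Q * u = aeval θ P := by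
  have h : u ∈ IntermediateField.adjoin M {θ} := by
    refine Subfield.closure_mono (Set.union_subset_union_left _ ?_) hu
    intro x hx
    exact ⟨⟨x, hx⟩, rfl⟩
  obtain ⟨r, s, h⟩ := IntermediateField.mem_adjoin_simple_iff _ _ |>.1 h
  by_cases hs : aeval θ s = 0
  · refine ⟨0, 1, by simp, ?_⟩
    simp [h, hs]
  · exact ⟨r, s, fun h0 => hs (by simp [h0]), by rw [h]; field_simp⟩

/-- If a combination of the logarithmic derivatives of the `θ - α j` with coefficients in `M` is,
modulo `M`, the derivative of an element of `M(θ)`, then the residues at the non-special `α i`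
vanish. -/
theorem Subfield.residue_eq_zero {K : Type*} [Field K] [Differential K] [CharZero K]
    {M : Subfield K} (hM : M.IsDifferential) {θ : K} (hθ : Transcendental M θ) {p : M[X]}
    (hp : θ′ = aeval θ p) {ι : Type*} [Fintype ι] {α ρ : ι → K} (hα : Function.Injective α)
    (hαM : ∀ j, α j ∈ M) (hρ : ∀ j, ρ j ∈ M) {u a : K} (ha : a ∈ M)
    (hu : u ∈ Subfield.closure (M ∪ {θ} : Set K))
    (h : ∑ j, ρ j * ((θ - α j)′ / (θ - α j)) + a = u′) {i : ι} (hi : aeval (α i) p ≠ (α i)′) :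
    ρ i = 0 := by
  classical
  let _ := hM.toDifferential
  have := hM.differentialAlgebra
  have hreg : RegularAt θ (⟨α i, hαM i⟩ : M) (u′ - algebraMap M K ⟨ρ i, hρ i⟩ *
      ((θ - algebraMap M K ⟨α i, hαM i⟩)′ / (θ - algebraMap M K ⟨α i, hαM i⟩))) := by
    change RegularAt θ (⟨α i, hαM i⟩ : M) (u′ - ρ i * ((θ - α i)′ / (θ - α i)))
    rw [← h, ← Finset.add_sum_erase _ _ (Finset.mem_univ i), add_assoc, add_sub_cancel_left]
    refine RegularAt.add (RegularAt.sum fun j hj => ?_) (regularAt_algebraMap θ _ (⟨a, ha⟩ : M))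
    refine RegularAt.mul (regularAt_algebraMap θ _ (⟨ρ j, hρ j⟩ : M)) ?_
    refine ⟨p - C (⟨(α j)′, hM _ (hαM j)⟩ : M), X - C (⟨α j, hαM j⟩ : M), ?_, ?_⟩
    · simp only [eval_sub, eval_X, eval_C, Ne, sub_eq_zero, Subtype.mk.injEq]
      exact fun h' => (Finset.ne_of_mem_erase hj) (hα h').symm
    · have h0 : θ - α j ≠ 0 := fun h0 => hθ (by
        rw [sub_eq_zero.1 h0]
        exact isAlgebraic_algebraMap (⟨α j, hαM j⟩ : M))
      have e1 : aeval θ (X - C (⟨α j, hαM j⟩ : M)) = θ - α j := by simp; rfl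
      have e2 : aeval θ (p - C (⟨(α j)′, hM _ (hαM j)⟩ : M)) = (θ - α j)′ := by
        simp [hp]; rfl
      rw [e1, e2]
      field_simp
  have := _root_.residue_eq_zero hθ hp (α := (⟨α i, hαM i⟩ : M)) (fun h' => hi ?_)
    (Subfield.exists_aeval_of_mem_closure_singleton hu) hreg
  · exact congrArg Subtype.val this
  · have e : aeval (α i) p = ((p.eval (⟨α i, hαM i⟩ : M) : M) : K) :=
      aeval_algebraMap_apply_eq_algebraMap_eval (A := K) (⟨α i, hαM i⟩ : M) p
    rw [e, h']
    rfl

end Residue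

/-! ### Adjoining primitives one at a time -/

section Adjoin

variable {K : Type*} [Field K]

theorem Subfield.closure_union_induction {P : Subfield K → Prop} {M : Subfield K} {S : Set K}
    (hS : S.Finite) (h0 : P M)
    (step : ∀ N : Subfield K, M ≤ N → P N → ∀ z ∈ S, P (Subfield.closure (N ∪ {z} : Set K))) :
    P (Subfield.closure (M ∪ S : Set K)) := by
  induction S, hS using Set.Finite.induction_on with
  | empty => simpa using h0
  | @insert z S _ _ ih =>
    have h := step (Subfield.closure (M ∪ S : Set K))
      (fun x hx => Subfield.subset_closure (Or.inl hx))
      (ih fun N hN hP w hw => step N hN hP w (Set.mem_insert_of_mem z hw)) z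
      (Set.mem_insert z S)
    rwa [Subfield.closure_union, Subfield.closure_eq, ← Subfield.closure_union, Set.union_assoc,
      Set.union_singleton] at h

variable [Differential K] {M : Subfield K}

/-- If c z' = u' with c a nonzero constant, then c z - u is a constant, hence in `M`, and so is z.
-/
theorem Subfield.mem_or_indepModDerivIn (hC : ∀ x : K, x′ = 0 → x ∈ M) (z : K) :
    z ∈ M ∨ IndepModDerivIn M (fun _ : Unit => z) := by
  rw [or_iff_not_imp_right]
  intro h
  simp only [IndepModDerivIn, not_forall] at h
  obtain ⟨c, hc, hc', u, hu, hcu, _, hne⟩ := h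
  simp only [Finset.univ_unique, PUnit.default_eq_unit, Finset.sum_singleton] at hcu
  have h : (c () * z - u)′ = 0 := by
    rw [map_sub, Derivation.leibniz, hc', smul_zero, add_zero, smul_eq_mul, hcu, sub_self]
  have h2 := mul_mem (inv_mem (hc ())) (add_mem (hC _ h) hu)
  rwa [sub_add_cancel, inv_mul_cancel_left₀ hne] at h2

theorem Subfield.closure_union_singleton_of_mem {K : Type*} [Field K] {M : Subfield K} {z : K}
    (hz : z ∈ M) : Subfield.closure (M ∪ {z} : Set K) = M := by
  rw [Set.union_singleton, Set.insert_eq_of_mem hz, Subfield.closure_eq]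

theorem Subfield.IsDifferential.closure_union_singleton (hM : M.IsDifferential) {z : K}
    (hz : z′ ∈ M) : (Subfield.closure (M ∪ {z} : Set K)).IsDifferential := by
  have := hM.closure_union_range (y := fun _ : Unit => z) fun _ => hz
  rwa [Set.range_const] at this

open Polynomial in
/-- An element algebraic over `N` with logarithmic derivative in `N` has a power which is a
constant multiple of an element of `N`. -/
theorem Subfield.IsDifferential.exists_deriv_eq_natCast_mul {N : Subfield K}
    (hN : N.IsDifferential) {θ b : K} (hb : b ∈ N) (hθ0 : θ ≠ 0) (hθ : θ′ = b * θ)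
    (halg : IsAlgebraic N θ) :
    ∃ n : ℕ, n ≠ 0 ∧ ∃ v ∈ N, v ≠ 0 ∧ v′ = n * b * v := by
  let _ := hN.toDifferential
  have := hN.differentialAlgebra
  have hint := halg.isIntegral
  set P := minpoly N θ with hP
  have hmonic : P.Monic := minpoly.monic hint
  have hn : 0 < P.natDegree := minpoly.natDegree_pos hint
  set n := P.natDegree with hnd
  set β : N := ⟨b, hb⟩
  -- `R` represents the derivative of P(θ) minus n b P(θ), so it vanishes at θ. Its terms of degree
  -- n cancel, so `R = 0` by minimality, and its constant term is the required equation for `P.coeff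
  -- 0`.
  set R : N[X] := Differential.mapCoeffs P + C β * (derivative P * X) - C (n * β) * P with hR
  have hRθ : aeval θ R = 0 := by
    have h := Differential.deriv_aeval_eq θ P
    rw [hP, minpoly.aeval, map_zero, ← hP, hθ] at h
    simp only [hR, map_sub, map_add, map_mul, aeval_C, aeval_X]
    rw [hP, minpoly.aeval, ← hP]
    have hβ : algebraMap N K β = b := rfl
    rw [hβ]
    linear_combination -h
  have hRc : ∀ m, R.coeff (m + 1) =
      (P.coeff (m + 1))′ + β * (P.coeff (m + 1) * (m + 1)) - n * β * P.coeff (m + 1) := fun m => by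
    simp only [hR, coeff_sub, coeff_add, Differential.coeff_mapCoeffs, coeff_C_mul, coeff_mul_X,
      coeff_derivative]
  have hR0 : R = 0 := by
    refine eq_zero_of_dvd_of_degree_lt (minpoly.dvd N θ hRθ) ?_
    rw [← hP, degree_eq_natDegree hmonic.ne_zero, degree_lt_iff_coeff_zero]
    intro m hm
    obtain ⟨m, rfl⟩ : ∃ j, m = j + 1 := ⟨m - 1, by omega⟩
    rw [hRc]
    rcases hm.eq_or_lt with h | h
    · have h1 : P.coeff (m + 1) = 1 := by rw [← h]; exact hmonic
      have h2 : (n : N) = m + 1 := by rw [← hnd] at h; rw [h]; push_cast; ring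
      rw [h1, h2, Derivation.map_one_eq_zero]
      ring
    · rw [coeff_eq_zero_of_natDegree_lt h, map_zero]
      ring
  have h0 : (P.coeff 0)′ = n * β * P.coeff 0 := by
    have := congrArg (fun p => coeff p 0) hR0
    simp only [hR, coeff_sub, coeff_add, Differential.coeff_mapCoeffs, coeff_C_zero, mul_coeff_zero,
      coeff_X_zero, mul_zero, add_zero, coeff_zero] at this
    exact sub_eq_zero.1 this
  refine ⟨n, hn.ne', P.coeff 0, Subtype.prop _, fun h => ?_, ?_⟩
  · exact minpoly.coeff_zero_ne_zero hint hθ0 (Subtype.ext h)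
  · have := congrArg Subtype.val h0
    refine Eq.trans this ?_
    simp [β]

variable [CharZero K]

/-- Were θ algebraic over M(z), some nonzero v in M(z) would satisfy v' = n b v. Such a v lies in M,
and v/θⁿ is constant, so θⁿ would lie in M. -/
theorem Subfield.transcendental_closure_union_singleton (hM : M.IsDifferential)
    (hC : ∀ x : K, x′ = 0 → x ∈ M) {θ b : K} (hθt : Transcendental M θ) (hb : b ∈ M)
    (hθ : θ′ = b * θ) {z : K} (hz : z′ ∈ M) :
    Transcendental (Subfield.closure (M ∪ {z} : Set K)) θ := by
  rcases Subfield.mem_or_indepModDerivIn hC z with h | h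
  · rwa [Subfield.closure_union_singleton_of_mem h]
  · intro halg
    have hθ0 : θ ≠ 0 := fun h0 => hθt (h0 ▸ isAlgebraic_zero)
    obtain ⟨n, hn, v, hv, hv0, hv'⟩ :=
      (hM.closure_union_singleton hz).exists_deriv_eq_natCast_mul
        (Subfield.subset_closure (Or.inl hb)) hθ0 hθ halg
    have hvM : v ∈ M := h.mem_of_deriv_eq_mul hM (fun _ => hz) (by rwa [Set.range_const]) hv0
      (mul_mem (natCast_mem M n) hb) hv'
    have hc : (v / θ ^ n)′ = 0 := by
      obtain ⟨m, rfl⟩ := Nat.exists_eq_succ_of_ne_zero hn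
      rw [Derivation.leibniz_div, Derivation.leibniz_pow, hv', hθ]
      simp only [nsmul_eq_mul, smul_eq_mul, Nat.succ_eq_add_one, Nat.add_sub_cancel]
      ring
    have hpow : θ ^ n = v / (v / θ ^ n) := by field_simp
    refine hθt.pow (Nat.pos_of_ne_zero hn) ?_
    rw [hpow]
    exact isAlgebraic_algebraMap (⟨_, div_mem hvM (hC _ hc)⟩ : M)

/-- No nontrivial combination of the `r i` with constant coefficients is the sum of an element of
`A` and the derivative of an element of `M`. -/
def IndepModDerivAdd {ι : Type*} [Fintype ι] (A M : Subfield K) (r : ι → K) : Prop :=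
  ∀ c : ι → K, (∀ i, (c i)′ = 0) → ∀ a ∈ A, ∀ u ∈ M, ∑ i, c i * r i + a = u′ → ∀ i, c i = 0

/-- An integral in M(z) of an element of M is v z + v₀ with v constant. Its derivative contributes v
z', which lies in `A`; the summand from `A` in the definition is there to absorb it. -/
theorem IndepModDerivAdd.closure_union_singleton {ι : Type*} [Fintype ι] {A : Subfield K}
    {r : ι → K} (hM : M.IsDifferential) (hAM : A ≤ M) (hC : ∀ x : K, x′ = 0 → x ∈ A)
    (hr : ∀ i, r i ∈ M) (h : IndepModDerivAdd A M r) {z : K} (hz : z′ ∈ A) :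
    IndepModDerivAdd A (Subfield.closure (M ∪ {z} : Set K)) r := by
  rcases Subfield.mem_or_indepModDerivIn (fun x hx => hAM (hC x hx)) z with hzM | hind
  · rwa [Subfield.closure_union_singleton_of_mem hzM]
  · intro c hc a ha u hu hsum
    have hmem : ∑ i, c i * r i + a ∈ M :=
      add_mem (sum_mem fun i _ => mul_mem (hAM (hC _ (hc i))) (hr i)) (hAM ha)
    obtain ⟨q, v, v₀, hq, hq', _, hv, hv₀, h1, h0⟩ := hind.exists_of_deriv_eq_linear hM
      (fun _ => hAM hz) (w := u) (by rwa [Set.range_const]) (s := fun _ => 0)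
      (fun _ => zero_mem M) hmem (by simp [hsum])
    have hq0 := hind (fun _ => q () ()) (fun _ => hq _ _) (fun _ => hq' _ _) (-v ())
      (neg_mem (hv _)) (by
        have := h1 ()
        simp only [Finset.univ_unique, PUnit.default_eq_unit, Finset.sum_singleton] at this ⊢
        rw [map_neg]; linear_combination this) ()
    have hv' : (v ())′ = 0 := by
      have := h1 ()
      simp only [Finset.univ_unique, PUnit.default_eq_unit, Finset.sum_singleton] at this
      simpa [hq0] using this
    refine h c hc (a - v () * z′) (sub_mem ha (mul_mem (hC _ hv') hz)) v₀ hv₀ ?_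
    simp only [Finset.univ_unique, PUnit.default_eq_unit, Finset.sum_singleton] at h0
    linear_combination -h0

end Adjoin

/-! ### Extension of constants -/

section Constants

variable {K : Type*} [Field K] [Differential K]

/-- Constants that are linearly independent over the constants of a differential subfield `k` are
linearly independent over `k`. -/
theorem Subfield.IsDifferential.eq_zero_of_sum_mul_const {k : Subfield K} (hk : k.IsDifferential)
    {ι : Type*} (s : Finset ι) (e : ι → K) (he : ∀ i ∈ s, (e i)′ = 0)
    (hind : ∀ c : ι → K, (∀ i ∈ s, c i ∈ k) → (∀ i ∈ s, (c i)′ = 0) → ∑ i ∈ s, c i * e i = 0 →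
      ∀ i ∈ s, c i = 0)
    (x : ι → K) (hx : ∀ i ∈ s, x i ∈ k) (h : ∑ i ∈ s, x i * e i = 0) : ∀ i ∈ s, x i = 0 := by
  classical
  induction s using Finset.strongInduction generalizing x with
  | H s ih =>
  by_contra! hne
  obtain ⟨j, hj, hxj⟩ := hne
  have hy : ∀ i ∈ s, x i / x j ∈ k := fun i hi => div_mem (hx i hi) (hx j hj)
  have hsum : ∑ i ∈ s, x i / x j * e i = 0 := by
    have : ∑ i ∈ s, x i / x j * e i = (x j)⁻¹ * ∑ i ∈ s, x i * e i := by
      rw [Finset.mul_sum]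
      exact Finset.sum_congr rfl fun i _ => by ring
    rw [this, h, mul_zero]
  have hyj : (x j / x j)′ = 0 := by rw [div_self hxj, Derivation.map_one_eq_zero]
  -- The coefficient at `j` is now 1, so differentiating yields a relation over `s.erase j`. By
  -- induction all quotients `x i / x j` are constants, and `hind` applies to them.
  have hder : ∑ i ∈ s, (x i / x j)′ * e i = 0 := by
    have := congrArg (Differential.deriv) hsum
    rw [map_sum, map_zero] at this
    rw [← this]
    refine Finset.sum_congr rfl fun i hi => ?_
    rw [Derivation.leibniz, he i hi, smul_zero, zero_add, smul_eq_mul, mul_comm]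
  rw [← Finset.add_sum_erase _ _ hj, hyj, zero_mul, zero_add] at hder
  have hzero := ih (s.erase j) (Finset.erase_ssubset hj)
    (fun i hi => he i (Finset.mem_of_mem_erase hi))
    (fun c hc hc' hcs i hi => by
      have := hind (fun i => if i = j then 0 else c i)
        (fun i hi => by
          split_ifs with h
          · exact zero_mem k
          · exact hc i (Finset.mem_erase.2 ⟨h, hi⟩))
        (fun i hi => by
          split_ifs with h
          · exact map_zero _
          · exact hc' i (Finset.mem_erase.2 ⟨h, hi⟩))
        (by
          rw [← Finset.add_sum_erase _ _ hj, if_pos rfl, zero_mul, zero_add, ← hcs]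
          exact Finset.sum_congr rfl fun i hi => by rw [if_neg (Finset.ne_of_mem_erase hi)])
        i (Finset.mem_of_mem_erase hi)
      rwa [if_neg (Finset.ne_of_mem_erase hi)] at this)
    (fun i => (x i / x j)′) (fun i hi => hk _ (hy i (Finset.mem_of_mem_erase hi))) hder
  have := hind (fun i => x i / x j) hy (fun i hi => by
    by_cases hij : i = j
    · rw [hij, hyj]
    · exact hzero i (Finset.mem_erase.2 ⟨hij, hi⟩)) hsum j hj
  simp [hxj] at this

/-- The constants of a differential subfield. -/
def Subfield.constants (M : Subfield K) : Subfield K where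
  carrier := {x | x ∈ M ∧ x′ = 0}
  mul_mem' := fun ⟨hx, hx'⟩ ⟨hy, hy'⟩ => ⟨mul_mem hx hy, by simp [hx', hy']⟩
  one_mem' := ⟨one_mem M, by simp⟩
  add_mem' := fun ⟨hx, hx'⟩ ⟨hy, hy'⟩ => ⟨add_mem hx hy, by simp [hx', hy']⟩
  zero_mem' := ⟨zero_mem M, by simp⟩
  neg_mem' := fun ⟨hx, hx'⟩ => ⟨neg_mem hx, by simp [hx']⟩
  inv_mem' := fun x ⟨hx, hx'⟩ => ⟨inv_mem hx, by simp [Derivation.leibniz_inv, hx']⟩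

open Polynomial IntermediateField.algebraAdjoinAdjoin in
/-- Adjoining all constants of `K` to `M` preserves the transcendence of `θ` if `M(θ)` has no new
constants. -/
theorem Subfield.transcendental_closure_union_constants {M : Subfield K} {θ : K}
    (hk : (Subfield.closure (M ∪ {θ} : Set K)).IsDifferential)
    (hC : ∀ x ∈ Subfield.closure (M ∪ {θ} : Set K), x′ = 0 → x ∈ M) (hθ : Transcendental M θ) :
    Transcendental (Subfield.closure (M ∪ {x : K | x′ = 0} : Set K)) θ := by
  classical
  set k := Subfield.closure (M ∪ {θ} : Set K)
  set C : Set K := {x : K | x′ = 0} with hCdef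
  -- `b` is a basis of the constants of `K` over those of `M`. As `C` is multiplicatively closed, it
  -- also spans M[C] over `M`, so an equation for θ over M[C] can be split along `b`.
  obtain ⟨b, hbC, hbspan, hb⟩ := exists_linearIndependent M.constants C
  have hadj : Subfield.closure (M ∪ C : Set K) = (IntermediateField.adjoin M C).toSubfield := by
    refine congrArg (fun S : Set K => Subfield.closure (S ∪ C)) ?_
    ext x
    exact ⟨fun hx => ⟨⟨x, hx⟩, rfl⟩, by rintro ⟨y, rfl⟩; exact y.2⟩
  rw [hadj]
  change Transcendental (IntermediateField.adjoin M C) θ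
  intro halg
  obtain ⟨p, hp0, hp⟩ :=
    (IsFractionRing.isAlgebraic_iff (Algebra.adjoin M C) (IntermediateField.adjoin M C) K).2 halg
  have hspan : ∀ i, (p.coeff i : K) ∈ Submodule.span M b := fun i => by
    have h1 : (p.coeff i : K) ∈ Subalgebra.toSubmodule (Algebra.adjoin M C) := (p.coeff i).2
    have hmon : (Submonoid.closure C : Set K) = C := by
      refine le_antisymm ?_ Submonoid.subset_closure
      intro x hx
      induction hx using Submonoid.closure_induction with
      | mem x hx => exact hx
      | one => simp [hCdef]
      | mul x y _ _ hx hy =>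
        simp only [hCdef, Set.mem_ofPred_eq] at hx hy ⊢
        simp [hx, hy]
    rw [Algebra.adjoin_eq_span, hmon] at h1
    refine Submodule.span_le.2 ?_ h1
    intro x hx
    have h2 : ∀ x ∈ Submodule.span M.constants b, x ∈ Submodule.span M b := fun x hx => by
      induction hx using Submodule.span_induction with
      | mem x hx => exact Submodule.subset_span hx
      | zero => exact zero_mem _
      | add x y _ _ hx hy => exact add_mem hx hy
      | smul c x _ hx => exact Submodule.smul_mem _ (⟨c, c.2.1⟩ : M) hx
    exact h2 x (hbspan ▸ Submodule.subset_span hx)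
  choose f hf using fun i => Finsupp.mem_span_iff_linearCombination M b _ |>.1 (hspan i)
  set T : Finset b := (Finset.range (p.natDegree + 1)).biUnion fun i => (f i).support with hT
  have hcoeff : ∀ i ∈ Finset.range (p.natDegree + 1),
      (p.coeff i : K) = ∑ e ∈ T, (f i e : K) * e := fun i hi => by
    rw [← hf i, Finsupp.linearCombination_apply, Finsupp.sum]
    refine Finset.sum_subset (Finset.subset_biUnion_of_mem (fun i => (f i).support) hi) ?_
    intro e _ he
    rw [Finsupp.notMem_support_iff.1 he, zero_smul]
  -- By `hC`, M(θ) has the same constants as `M`, so `b` stays independent over M(θ), and each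
  -- component is a polynomial relation for θ over `M`.
  have hq : ∀ e ∈ T, ∑ i ∈ Finset.range (p.natDegree + 1), (f i e : K) * θ ^ i = 0 := by
    refine hk.eq_zero_of_sum_mul_const T (fun e : b => (e : K)) (fun e _ => hbC e.2) ?_ _ ?_ ?_
    · intro c hc hc' hsum e he
      rw [linearIndependent_iff'] at hb
      have := hb T (fun e => if h : e ∈ T then ⟨c e, hC _ (hc e h) (hc' e h), hc' e h⟩ else 0)
        (by
          refine Eq.trans (Finset.sum_congr rfl fun e he => ?_) hsum
          rw [dif_pos he]
          rfl) e he
      rw [dif_pos he] at this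
      exact congrArg Subtype.val this
    · intro e _
      have hθk : θ ∈ k := Subfield.subset_closure (Or.inr rfl)
      exact sum_mem fun i _ =>
        mul_mem (Subfield.subset_closure (Or.inl (Subtype.prop _))) (pow_mem hθk _)
    · rw [aeval_eq_sum_range] at hp
      rw [← hp]
      simp only [Finset.sum_mul]
      rw [Finset.sum_comm]
      refine Finset.sum_congr rfl fun i hi => ?_
      rw [Algebra.smul_def]
      change _ = (p.coeff i : K) * _
      rw [hcoeff i hi, Finset.sum_mul]
      exact Finset.sum_congr rfl fun e _ => by ring
  have hf0 : ∀ e ∈ T, ∀ i ∈ Finset.range (p.natDegree + 1), f i e = 0 := fun e he i hi => by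
    have h0 : (∑ i ∈ Finset.range (p.natDegree + 1), Polynomial.C (f i e) * X ^ i : M[X]) = 0 := by
      refine transcendental_iff_injective.1 hθ ?_
      rw [map_zero, map_sum, ← hq e he]
      simp only [map_mul, aeval_C, map_pow, aeval_X]
      rfl
    have := congrArg (fun q => coeff q i) h0
    simp only [finsetSum_coeff, coeff_C_mul_X_pow, coeff_zero] at this
    rw [Finset.sum_eq_single i] at this
    · simpa using this
    · intro j _ hj
      rw [if_neg hj.symm]
    · exact fun h => absurd hi h
  refine hp0 (Polynomial.ext fun i => ?_)
  by_cases hi : i ∈ Finset.range (p.natDegree + 1)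
  · refine Subtype.ext ?_
    rw [hcoeff i hi, Finset.sum_eq_zero fun e he => by rw [hf0 e he i hi]; simp]
    simp
  · rw [coeff_eq_zero_of_natDegree_lt (by simpa using hi), coeff_zero]

end Constants

/-! ### Vanishing of the coefficients -/

section Core

variable {K : Type*} [Field K] [Differential K] [CharZero K] {ι : Type*} [Fintype ι] [DecidableEq ι]

/-- Comparison of coefficients for an integral of a combination of derivatives of dilogarithms:
the `l j` with `J j` are independent over `G`, the others lie in `G`. -/
theorem dilog_coeff_comparison {G : Subfield K} (hG : G.IsDifferential)
    (hC : ∀ x : K, x′ = 0 → x ∈ G) {J : ι → Prop} [DecidablePred J] {r l : ι → K}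
    (hl : ∀ j, (l j)′ = r j) (hr : ∀ j, r j ∈ G) (hlG : ∀ j, ¬ J j → l j ∈ G)
    (hind : IndepModDerivIn G (fun i : {j // J j} => l i)) {L c : ι → ι → K}
    (hL : ∀ j k, L j k ∈ G) (hc : ∀ j k, (c j k)′ = 0) (hanti : ∀ j k, c j k = 0 ∨ c k j = 0)
    {w : K} (hw : w ∈ Subfield.closure (G ∪ Set.range l : Set K))
    (hw' : w′ = ∑ j, ∑ k, c j k * ((r j - r k) * (l k - L j k))) :
    (∀ j k, J j → J k → c j k = 0) ∧ ∃ (v : {j // J j} → K) (v₀ : K), (∀ i, v i ∈ G) ∧ v₀ ∈ G ∧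
      (∀ i, (v i)′ = ∑ j : {j // ¬ J j}, c j i * r j) ∧
      v₀′ + ∑ i, v i * r i = ∑ k : {j // ¬ J j}, ∑ j, c j k * ((r j - r k) * l k)
        - ∑ j, ∑ k, c j k * ((r j - r k) * L j k) := by
  have hw2 : w ∈ Subfield.closure (G ∪ Set.range (fun i : {j // J j} => l i) : Set K) := by
    refine Subfield.closure_le.2 ?_ hw
    rintro x (hx | ⟨j, rfl⟩)
    · exact Subfield.subset_closure (Or.inl hx)
    · by_cases hj : J j
      · exact Subfield.subset_closure (Or.inr ⟨⟨j, hj⟩, rfl⟩)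
      · exact Subfield.subset_closure (Or.inl (hlG j hj))
  have hcG : ∀ j k, c j k ∈ G := fun j k => hC _ (hc j k)
  obtain ⟨q, v, v₀, hqG, hq, hqs, hv, hv₀, h1, h0⟩ := hind.exists_of_deriv_eq_linear hG
    (fun i => by rw [hl]; exact hr i) hw2
    (s := fun i => ∑ j, c j i * (r j - r i))
    (s₀ := ∑ k : {j // ¬ J j}, ∑ j, c j k * ((r j - r k) * l k)
        - ∑ j, ∑ k, c j k * ((r j - r k) * L j k))
    (fun i => sum_mem fun j _ => mul_mem (hcG j i) (sub_mem (hr _) (hr _)))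
    (sub_mem
      (sum_mem fun k _ => sum_mem fun j _ =>
        mul_mem (hcG _ _) (mul_mem (sub_mem (hr _) (hr _)) (hlG _ k.2)))
      (sum_mem fun j _ => sum_mem fun k _ =>
        mul_mem (hcG _ _) (mul_mem (sub_mem (hr _) (hr _)) (hL _ _))))
    (by
      rw [hw']
      simp only [mul_sub (_ - _), mul_sub (c _ _) (_ * _), Finset.sum_sub_distrib]
      rw [Finset.sum_comm, ← Fintype.sum_subtype_add_sum_subtype J, ← add_sub_assoc]
      simp only [Finset.sum_mul, mul_assoc])
  simp only [hl] at h1 h0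
  -- The coefficient of `l i` gives a constant combination of the `r j` with `J j` that is a
  -- derivative in `G`: the other `r j` integrate to `l j ∈ G`.
  have hd : ∀ i j : {j // J j}, q i j - c j i + (if j = i then ∑ k, c k i else 0) = 0 := fun i => by
    refine hind (fun j => q i j - c j i + (if j = i then ∑ k, c k i else 0)) (fun j => ?_)
      (fun j => ?_) (- v i + ∑ j : {j // ¬ J j}, c j i * l j) ?_ ?_
    · refine hC _ ?_
      split_ifs <;> simp [hq, hc]
    · split_ifs <;> simp [hq, hc]
    · exact add_mem (neg_mem (hv i)) (sum_mem fun j _ => mul_mem (hcG _ _) (hlG _ j.2))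
    · have h2 := h1 i
      simp only [mul_sub, Finset.sum_sub_distrib] at h2
      rw [← Fintype.sum_subtype_add_sum_subtype J (fun j => c j i * r j)] at h2
      simp only [hl, add_mul, sub_mul, ite_mul, zero_mul, Finset.sum_add_distrib,
        Finset.sum_sub_distrib, Finset.sum_ite_eq', Finset.mem_univ, if_true, map_add, map_neg,
        map_sum, Derivation.leibniz, hc, smul_eq_mul, mul_zero,
        Finset.sum_add_distrib, Finset.sum_const_zero, Finset.sum_mul]
      linear_combination h2
  -- Off the diagonal `q i j = c j i`, so symmetry of `q` passes to `c`, and `hanti` leaves only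
  -- zero.
  have hJ : ∀ j k, J j → J k → c j k = 0 := fun j k hj hk => by
    by_cases hjk : j = k
    · subst hjk
      simpa using hanti j j
    · have e1 := hd ⟨j, hj⟩ ⟨k, hk⟩
      have e2 := hd ⟨k, hk⟩ ⟨j, hj⟩
      rw [if_neg (by simpa using Ne.symm hjk), add_zero] at e1
      rw [if_neg (by simpa using hjk), add_zero, hqs] at e2
      rcases hanti j k with h | h
      · exact h
      · rw [← sub_eq_zero.1 e2, sub_eq_zero.1 e1, h]
  refine ⟨hJ, v, v₀, hv, hv₀, fun i => ?_, h0⟩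
  have h2 := h1 i
  have h3 : ∑ j : {j // J j}, q i j * r j = - ((∑ k, c k i) * r i) := by
    have : ∀ j : {j // J j}, q i j * r j =
        (c j i * r j) - if j = i then (∑ k, c k i) * r i else 0 := fun j => by
      have := hd i j
      split_ifs at this ⊢ with h
      · subst h; linear_combination r j * this
      · linear_combination r j * this
    simp only [this, Finset.sum_sub_distrib, Finset.sum_ite_eq', Finset.mem_univ, if_true]
    rw [Finset.sum_eq_zero fun j _ => by rw [hJ _ _ j.2 i.2, zero_mul], zero_sub]
  simp only [mul_sub, Finset.sum_sub_distrib] at h2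
  have h4 : ∑ j : {j // J j}, c j i * r j = 0 :=
    Finset.sum_eq_zero fun j _ => by rw [hJ _ _ j.2 i.2, zero_mul]
  rw [← Fintype.sum_subtype_add_sum_subtype J (fun j => c j i * r j), h4, h3, ← Finset.sum_mul]
    at h2
  linear_combination h2

theorem sum_sum_eq_sum_subtype_ne {R : Type*} [AddCommMonoid R] {f : ι → ι → R} {j₀ : ι}
    (h : ∀ j k, j ≠ j₀ → k ≠ j₀ → f j k = 0) (h0 : f j₀ j₀ = 0) :
    ∑ j, ∑ k, f j k = ∑ i : {j // j ≠ j₀}, (f j₀ i + f i j₀) := by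
  rw [Fintype.sum_eq_add_sum_subtype_ne _ j₀, Fintype.sum_eq_add_sum_subtype_ne _ j₀, h0, zero_add,
    ← Finset.sum_add_distrib]
  refine Finset.sum_congr rfl fun i _ => ?_
  rw [Fintype.sum_eq_single j₀ fun k hk => h i k i.2 hk]

/-- An exponential `θ`: the differential relation forces all coefficients to vanish, `j₀` being the
index with `α j₀ = 0`. -/
theorem dilog_coeff_eq_zero_of_exp {M : Subfield K} (hM : M.IsDifferential)
    (hC : ∀ x : K, x′ = 0 → x ∈ M) {θ b : K} (hθ : Transcendental M θ) (hb : b ∈ M)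
    (hθ' : θ′ = b * θ) {α l : ι → K} (hα : Function.Injective α) (hαM : ∀ j, α j ∈ M)
    (hl : ∀ j, (l j)′ = (θ - α j)′ / (θ - α j)) (hlM : ∀ j, α j = 0 → l j ∈ M)
    {L c : ι → ι → K} (hLM : ∀ j k, L j k ∈ M) (hc : ∀ j k, (c j k)′ = 0)
    (hanti : ∀ j k, c j k = 0 ∨ c k j = 0)
    (hL : ∀ j k, c j k ≠ 0 → (L j k)′ = (α j - α k)′ / (α j - α k))
    {w : K}
    (hw : w ∈ Subfield.closure (Subfield.closure (M ∪ {θ} : Set K) ∪ Set.range l : Set K))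
    (hw' : w′ = ∑ j, ∑ k, c j k * (((l j)′ - (l k)′) * (l k - L j k))) (j k : ι) :
    c j k = 0 := by
  set G := Subfield.closure (M ∪ {θ} : Set K) with hGdef
  have hMG : M ≤ G := fun x hx => Subfield.subset_closure (Or.inl hx)
  have hθG : θ ∈ G := Subfield.subset_closure (Or.inr rfl)
  have hG : G.IsDifferential := Subfield.isDifferential_closure (by
    rintro x (hx | rfl)
    · exact hMG (hM x hx)
    · rw [hθ']; exact mul_mem (hMG hb) hθG)
  have hrG : ∀ j, (l j)′ ∈ G := fun j => by
    have h := sub_mem hθG (hMG (hαM j))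
    rw [hl]; exact div_mem (hG _ h) h
  have hθ0 : θ ≠ 0 := fun h0 => hθ (h0 ▸ isAlgebraic_zero)
  -- Equality would make `θ / α i` constant and put θ in `M`.
  have hspecial : ∀ i, α i ≠ 0 → b * α i ≠ (α i)′ := fun i hi h => by
    refine hθ ?_
    have h2 : (θ / α i)′ = 0 := by
      rw [Derivation.leibniz_div, hθ', ← h, smul_eq_mul, smul_eq_mul]
      ring
    have h3 := mul_mem (hC _ h2) (hαM i)
    rw [div_mul_cancel₀ _ hi] at h3
    exact isAlgebraic_algebraMap (⟨θ, h3⟩ : M)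
  -- The coefficients `ρ` are allowed in `M`, not only constant: the final residue comparison needs
  -- this.
  have hres : ∀ (J : ι → Prop) [DecidablePred J], (∀ j, J j → α j ≠ 0) → ∀ ρ : {j // J j} → K,
      (∀ i, ρ i ∈ M) → ∀ a ∈ M, ∀ u ∈ G, ∑ i, ρ i * (l i)′ + a = u′ → ∀ i, ρ i = 0 := by
    intro J _ hJ ρ hρ a ha u hu hsum i
    refine Subfield.residue_eq_zero hM hθ (p := Polynomial.C ⟨b, hb⟩ * Polynomial.X)
      (by rw [hθ', map_mul, Polynomial.aeval_C, Polynomial.aeval_X]; rfl) (α := fun i : {j // J j} => α i) (hα.comp Subtype.val_injective)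
      (fun i => hαM i) hρ ha hu (by simpa only [hl] using hsum) (i := i) ?_
    rw [map_mul, Polynomial.aeval_C, Polynomial.aeval_X]
    exact hspecial i (hJ i i.2)
  have hind : ∀ (J : ι → Prop) [DecidablePred J], (∀ j, J j → α j ≠ 0) →
      IndepModDerivIn G (fun i : {j // J j} => l i) := fun J _ hJ c _ hc u hu hsum =>
    hres J hJ c (fun i => hC _ (hc i)) 0 (zero_mem M) u hu (by simpa using hsum)
  have hCG : ∀ x : K, x′ = 0 → x ∈ G := fun x hx => hMG (hC x hx)
  by_cases hz : ∃ j₀, α j₀ = 0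
  · obtain ⟨j₀, hj₀⟩ := hz
    have hJ : ∀ j, j ≠ j₀ → α j ≠ 0 := fun j hj h => hj (hα (h.trans hj₀.symm))
    have hb' : (l j₀)′ = b := by
      rw [hl, hj₀, sub_zero, hθ', mul_div_cancel_right₀ _ hθ0]
    have hlj₀ := hlM j₀ hj₀
    obtain ⟨hcJ, v, v₀, hv, hv₀, hv', hv₀'⟩ := dilog_coeff_comparison hG hCG (J := fun j => j ≠ j₀)
      (fun _ => rfl) hrG (fun j hj => hMG (by rwa [not_not.1 hj])) (hind _ hJ)
      (fun j k => hMG (hLM j k)) hc hanti hw hw'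
    have hc0 : c j₀ j₀ = 0 := by simpa using hanti j₀ j₀
    have hnot : ∀ f : ι → K, ∑ j : {j // ¬ j ≠ j₀}, f j = f j₀ := fun f => by
      have h1 := Fintype.sum_subtype_add_sum_subtype (fun j => j ≠ j₀) f
      rw [Fintype.sum_eq_add_sum_subtype_ne f j₀, add_comm] at h1
      exact add_right_cancel h1
    have hv'' : ∀ i, (v i)′ = c j₀ i * b := fun i => by
      rw [hv', hnot fun j => c j i * (l j)′, hb']
    -- `v i` differs from `c j₀ i * l j₀` by a constant.
    have hvM : ∀ i, v i ∈ M := fun i => by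
      have h : (v i - c j₀ i * l j₀)′ = 0 := by
        rw [map_sub, Derivation.leibniz, hv'', hc, hb', smul_eq_mul, smul_zero, add_zero, sub_self]
      have h2 := add_mem (hC _ h) (mul_mem (hC _ (hc j₀ i)) hlj₀)
      rwa [sub_add_cancel] at h2
    rw [hnot fun k => ∑ j, c j k * (((l j)′ - (l k)′) * l k),
      Fintype.sum_eq_add_sum_subtype_ne _ j₀, hc0, zero_mul, zero_add,
      sum_sum_eq_sum_subtype_ne (j₀ := j₀) (fun j k hj hk => by rw [hcJ j k hj hk, zero_mul])
        (by rw [hc0, zero_mul]), ← Finset.sum_sub_distrib, hb'] at hv₀'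
    -- These are the residues at θ = α i of the degree-zero equation `hv₀'`; everything else there
    -- lies in `M` or is a derivative.
    have hρ := hres _ hJ (fun i => v i - c j₀ i * L j₀ i + c i j₀ * (L i j₀ - l j₀))
      (fun i => add_mem (sub_mem (hvM i) (mul_mem (hC _ (hc _ _)) (hLM _ _)))
        (mul_mem (hC _ (hc _ _)) (sub_mem (hLM _ _) hlj₀)))
      (∑ i : {j // j ≠ j₀}, b * (c i j₀ * l j₀ + c j₀ i * L j₀ i - c i j₀ * L i j₀))
      (sum_mem fun i _ => mul_mem hb (sub_mem (add_mem (mul_mem (hC _ (hc _ _)) hlj₀)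
        (mul_mem (hC _ (hc _ _)) (hLM _ _))) (mul_mem (hC _ (hc _ _)) (hLM _ _))))
      (-v₀) (neg_mem hv₀) (by
        rw [map_neg, ← add_eq_zero_iff_eq_neg]
        have h1 := sub_eq_zero.2 hv₀'
        rw [add_sub_assoc, ← Finset.sum_sub_distrib] at h1
        rw [← h1, add_comm, ← Finset.sum_add_distrib]
        congr 1
        exact Finset.sum_congr rfl fun i _ => by ring)
    have hzero : ∀ i, i ≠ j₀ → c j₀ i = 0 ∧ c i j₀ = 0 := fun i hi => by
      -- Differentiating the residue leaves, up to sign, the one possibly nonzero coefficient times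
      -- `b - (α i)′ / α i`, which is not zero.
      have h1 := congrArg (Differential.deriv) (hρ ⟨i, hi⟩)
      simp only [map_add, map_sub, map_zero, Derivation.leibniz, hv'', hc, smul_eq_mul, mul_zero,
        add_zero, hb'] at h1
      have hαi := hJ i hi
      have hne : b - (α i)′ / α i ≠ 0 := fun h => hspecial i hαi (by
        rw [sub_eq_zero.1 h, div_mul_cancel₀ _ hαi])
      rcases hanti j₀ i with h | h
      · refine ⟨h, by_contra fun h' => ?_⟩
        have h2 := hL i j₀ h'
        rw [hj₀, sub_zero] at h2
        rw [h, h2] at h1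
        refine hne ((mul_eq_zero.1 (?_ : c i j₀ * _ = 0)).resolve_left h')
        linear_combination -h1
      · refine ⟨by_contra fun h' => ?_, h⟩
        have h2 := hL j₀ i h'
        rw [hj₀, zero_sub, map_neg, neg_div_neg_eq] at h2
        rw [h, h2] at h1
        refine hne ((mul_eq_zero.1 (?_ : c j₀ i * _ = 0)).resolve_left h')
        linear_combination h1
    by_cases hj : j = j₀
    · by_cases hk : k = j₀
      · rw [hj, hk, hc0]
      · rw [hj, (hzero k hk).1]
    · by_cases hk : k = j₀
      · rw [hk, (hzero j hj).2]
      · exact hcJ j k hj hk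
  · push Not at hz
    exact (dilog_coeff_comparison hG hCG (J := fun _ => True) (fun _ => rfl) hrG
      (fun j h => absurd trivial h) (hind _ fun j _ => hz j) (fun j k => hMG (hLM j k)) hc hanti hw
      hw').1 j k trivial trivial

/-- A primitive `θ`: the differential relation forces all coefficients to vanish. -/
theorem dilog_coeff_eq_zero_of_primitive {M : Subfield K} (hM : M.IsDifferential)
    (hC : ∀ x : K, x′ = 0 → x ∈ M) {θ : K} (hθ : Transcendental M θ) (hθ' : θ′ ∈ M)
    {α l : ι → K} (hα : Function.Injective α) (hαM : ∀ j, α j ∈ M)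
    (hl : ∀ j, (l j)′ = (θ - α j)′ / (θ - α j)) {Z : Set K} (hZ : Z.Finite)
    (hZM : ∀ z ∈ Z, z′ ∈ M)
    {L c : ι → ι → K} (hLM : ∀ j k, L j k ∈ Z) (hc : ∀ j k, (c j k)′ = 0)
    (hanti : ∀ j k, c j k = 0 ∨ c k j = 0)
    {w : K}
    (hw : w ∈ Subfield.closure (Subfield.closure (Subfield.closure (M ∪ {θ} : Set K) ∪ Z : Set K)
      ∪ Set.range l : Set K))
    (hw' : w′ = ∑ j, ∑ k, c j k * (((l j)′ - (l k)′) * (l k - L j k))) (j k : ι) :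
    c j k = 0 := by
  set N := Subfield.closure (M ∪ {θ} : Set K) with hNdef
  have hMN : M ≤ N := fun x hx => Subfield.subset_closure (Or.inl hx)
  have hθN : θ ∈ N := Subfield.subset_closure (Or.inr rfl)
  have hN : N.IsDifferential := hM.closure_union_singleton hθ'
  have hrN : ∀ j, (l j)′ ∈ N := fun j => by
    have h := sub_mem hθN (hMN (hαM j))
    rw [hl]; exact div_mem (hN _ h) h
  have h0 : IndepModDerivAdd M N (fun i : {j : ι // True} => (l i)′) := by
    intro c hc a ha u hu hsum i
    refine Subfield.residue_eq_zero hM hθ (p := Polynomial.C ⟨θ′, hθ'⟩) (by simp; rfl)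
      (α := fun i : {j : ι // True} => α i) (hα.comp Subtype.val_injective) (fun i => hαM i)
      (fun i => hC _ (hc i)) ha hu ?_ (i := i) ?_
    · simpa only [hl] using hsum
    · simp only [Polynomial.aeval_C]
      change θ′ ≠ _
      intro h
      refine hθ ?_
      have h2 : (θ - α i)′ = 0 := by rw [map_sub, h, sub_self]
      have h3 := add_mem (hC _ h2) (hαM i)
      rw [sub_add_cancel] at h3
      exact isAlgebraic_algebraMap (⟨θ, h3⟩ : M)
  -- A primitive θ might become algebraic over M(Z), so `Z` is adjoined above θ, and independence is
  -- carried along instead of transcendence.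
  obtain ⟨hNG, hG, hind⟩ := Subfield.closure_union_induction (M := N) (S := Z)
    (P := fun G => N ≤ G ∧ G.IsDifferential ∧
      IndepModDerivAdd M G (fun i : {j : ι // True} => (l i)′)) hZ ⟨le_rfl, hN, h0⟩
    (fun G _ ⟨hNG, hG, h⟩ z hz =>
      ⟨hNG.trans fun x hx => Subfield.subset_closure (Or.inl hx),
        hG.closure_union_singleton (hNG (hMN (hZM z hz))),
        IndepModDerivAdd.closure_union_singleton (r := fun i : {j : ι // True} => (l i)′) hG (hMN.trans hNG) hC
          (fun i => hNG (hrN i)) h (hZM z hz)⟩)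
  refine (dilog_coeff_comparison hG (fun x hx => hNG (hMN (hC x hx))) (J := fun _ => True)
    (fun _ => rfl) (fun j => hNG (hrN j)) (fun j h => absurd trivial h) ?_
    (fun j k => Subfield.subset_closure (Or.inr (hLM j k))) hc hanti hw hw').1 j k trivial trivial
  intro c _ hc u hu hsum
  exact hind c hc 0 (zero_mem M) u hu (by simpa using hsum)

end Core

/-! ### Assembly of the theorem -/

section Main

theorem AlgebraicIndependent.of_subfield_le {F K ι : Type*} [Field F] [Field K] [Algebra F K]
    {R : IntermediateField F K} {S : Subfield K} (hRS : ∀ x ∈ R, x ∈ S) {y : ι → K}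
    (h : AlgebraicIndependent S y) : AlgebraicIndependent R y := by
  let f : R →+* S := (algebraMap R K).codRestrict S fun x => hRS x x.2
  let _ : Algebra R S := f.toAlgebra
  have : IsScalarTower R S K := IsScalarTower.of_algebraMap_eq fun _ => rfl
  exact h.restrictScalars f.injective

variable {F K : Type*} [Field F] [Field K] [Algebra F K]

theorem Transcendental.fieldRange {θ : K} (hθ : Transcendental F θ) :
    Transcendental (algebraMap F K).fieldRange θ := by
  rintro ⟨p, hp0, hp⟩
  obtain ⟨q, rfl⟩ := Polynomial.map_surjective (algebraMap F K).rangeRestrictField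
    (algebraMap F K).rangeRestrictField_bijective.2 p
  refine hθ ⟨q, fun h => hp0 (by rw [h, Polynomial.map_zero]), ?_⟩
  rw [Polynomial.aeval_def, Polynomial.eval₂_map] at hp
  exact hp

variable [Differential K]

/-- The derivative of a dilogarithm of `x / y` in terms of logarithmic derivatives. -/
theorem IsDilogarithm.exists_of_div {l x y a : K} (hx : x ≠ 0) (hy : y ≠ 0) (ha : a ≠ 0)
    (hxy : y - x = a) (h : IsDilogarithm l (x / y)) :
    ∃ φ : K, φ′ = y′ / y - a′ / a ∧ l′ = (x′ / x - y′ / y) * φ := by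
  obtain ⟨_, _, φ, hφ, hl⟩ := h
  refine ⟨φ, ?_, ?_⟩
  · have h1 : 1 - x / y = a / y := by rw [← hxy]; field_simp
    have h2 := Differential.logDeriv_div a y ha hy
    simp only [Differential.logDeriv] at h2
    rw [hφ, h1, h2, neg_sub]
  · have h2 := Differential.logDeriv_div x y hx hy
    simp only [Differential.logDeriv] at h2
    rw [hl, h2]

/-- The differential relation between dilogarithms over a field containing all constants. -/
theorem dilog_coeff_eq_zero {K : Type*} [Field K] [Differential K] [CharZero K] {ι : Type*}
    [Fintype ι] [DecidableEq ι] {M : Subfield K} (hM : M.IsDifferential)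
    (hC : ∀ x : K, x′ = 0 → x ∈ M) {θ : K} (hθ : Transcendental M θ)
    (hθ' : θ′ ∈ M ∨ θ′ / θ ∈ M) {α l : ι → K} (hα : Function.Injective α) (hαM : ∀ j, α j ∈ M)
    (hl : ∀ j, (l j)′ = (θ - α j)′ / (θ - α j)) {Z : Set K} (hZ : Z.Finite)
    (hZM : ∀ z ∈ Z, z′ ∈ M) {L c : ι → ι → K} (hLM : ∀ j k, L j k ∈ Z)
    (hc : ∀ j k, (c j k)′ = 0) (hanti : ∀ j k, c j k = 0 ∨ c k j = 0)
    (hL : ∀ j k, c j k ≠ 0 → (L j k)′ = (α j - α k)′ / (α j - α k)) {w : K}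
    (hw : w ∈ Subfield.closure (M ∪ {θ} ∪ Z ∪ Set.range l : Set K))
    (hw' : w′ = ∑ j, ∑ k, c j k * (((l j)′ - (l k)′) * (l k - L j k))) (j k : ι) :
    c j k = 0 := by
  have hθ0 : θ ≠ 0 := fun h0 => hθ (h0 ▸ isAlgebraic_zero)
  rcases hθ' with hθ' | hb
  · refine dilog_coeff_eq_zero_of_primitive hM hC hθ hθ' hα hαM hl hZ hZM hLM hc hanti ?_ hw' j k
    refine Subfield.closure_mono (Set.union_subset_union_left _ ?_) hw
    refine (Set.union_subset_union_left _ Subfield.subset_closure).trans Subfield.subset_closure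
  · have hθ' : θ′ = θ′ / θ * θ := (div_mul_cancel₀ _ hθ0).symm
    set b := θ′ / θ
    -- A logarithm of θ itself, present when some `α j = 0`, has derivative `b ∈ M`. It goes below θ
    -- together with `Z`, and the exponential θ stays transcendental.
    set Z' := Z ∪ l '' {j | α j = 0}
    have hZ'M : ∀ z ∈ Z', z′ ∈ M := by
      rintro z (hz | ⟨j, hj, rfl⟩)
      · exact hZM z hz
      · rw [hl, show α j = 0 from hj, sub_zero, hθ', mul_div_cancel_right₀ _ hθ0]
        exact hb
    obtain ⟨hMN, hN, hNθ⟩ := Subfield.closure_union_induction (M := M) (S := Z')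
      (P := fun N => M ≤ N ∧ N.IsDifferential ∧ Transcendental N θ)
      (hZ.union (Set.toFinite _)) ⟨le_rfl, hM, hθ⟩
      (fun N _ ⟨hMN, hN, h⟩ z hz =>
        ⟨hMN.trans fun x hx => Subfield.subset_closure (Or.inl hx),
          hN.closure_union_singleton (hMN (hZ'M z hz)),
          Subfield.transcendental_closure_union_singleton hN (fun x hx => hMN (hC x hx)) h (hMN hb)
            hθ' (hMN (hZ'M z hz))⟩)
    have hZN : ∀ z ∈ Z', z ∈ Subfield.closure (M ∪ Z' : Set K) := fun z hz =>
      Subfield.subset_closure (Or.inr hz)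
    refine dilog_coeff_eq_zero_of_exp hN (fun x hx => hMN (hC x hx)) hNθ (hMN hb) hθ' hα
      (fun j => hMN (hαM j)) hl (fun j hj => hZN _ (Or.inr ⟨j, hj, rfl⟩))
      (fun j k => hZN _ (Or.inl (hLM j k))) hc hanti hL ?_ hw' j k
    refine Subfield.closure_mono (Set.union_subset_union_left _ ?_) hw
    rintro x ((hx | hx) | hx)
    · exact Subfield.subset_closure (Or.inl (hMN hx))
    · exact Subfield.subset_closure (Or.inr hx)
    · exact Subfield.subset_closure (Or.inl (hZN _ (Or.inl hx)))

end Main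

theorem mainTheorem7 {F K : Type*} [Field F] [CharZero F] [Differential F]
    [Field K] [Differential K] [Algebra F K] [DifferentialAlgebra F K]
    (θ : K) (hθ : Transcendental F θ) (hconst : NoNewConstants F⟮θ⟯)
    (hderiv : θ′ ∈ (algebraMap F K).range ∨ θ′ / θ ∈ (algebraMap F K).range)
    {t : ℕ} (ht : 3 ≤ t) (α : Fin t → F) (hα : Function.Injective α)
    (logα : Fin t → Fin t → K)
    (hlogα : ∀ j k, j ≠ k → IsLogarithm (logα j k) (algebraMap F K (α j - α k)))
    (logθ : Fin t → K)
    (hlogθ : ∀ j, IsLogarithm (logθ j) (θ - algebraMap F K (α j)))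
    (hE : NoNewConstants (logField F θ logα logθ))
    (dilog : Fin t → Fin t → K)
    (hdilog : ∀ j k, j < k → IsDilogarithm (dilog j k)
      ((θ - algebraMap F K (α j)) / (θ - algebraMap F K (α k)))) :
    AlgebraicIndependent (logField F θ logα logθ)
      (fun p : {p : Fin t × Fin t // p.1 < p.2} => dilog p.1.1 p.1.2) := by
  classical
  have : CharZero K := charZero_of_injective_algebraMap (algebraMap F K).injective
  have hθ0 : θ ≠ 0 := fun h0 => hθ (h0 ▸ isAlgebraic_zero)
  set M₀ := (algebraMap F K).fieldRange
  have hM₀ : M₀.IsDifferential := by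
    rintro _ ⟨x, rfl⟩
    exact ⟨x′, (deriv_algebraMap x).symm⟩
  set k := Subfield.closure (M₀ ∪ {θ} : Set K)
  have hM₀k : ∀ x ∈ M₀, x ∈ k := fun x hx => Subfield.subset_closure (Or.inl hx)
  have hθk : θ ∈ k := Subfield.subset_closure (Or.inr rfl)
  have hk : k.IsDifferential := Subfield.isDifferential_closure (by
    rintro x (hx | rfl)
    · exact hM₀k _ (hM₀ x hx)
    · rcases hderiv with h | h
      · exact hM₀k _ h
      · have := mul_mem (hM₀k _ h) hθk
        rwa [div_mul_cancel₀ _ hθ0] at this)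
  have hkC : ∀ x ∈ k, x′ = 0 → x ∈ M₀ := fun x hx => hconst x hx
  -- `K` may have constants outside `F`; all of them are adjoined. Independence over the resulting
  -- larger field implies the claim.
  set M := Subfield.closure (M₀ ∪ {x : K | x′ = 0} : Set K)
  have hM₀M : ∀ x ∈ M₀, x ∈ M := fun x hx => Subfield.subset_closure (Or.inl hx)
  have hC : ∀ x : K, x′ = 0 → x ∈ M := fun x hx => Subfield.subset_closure (Or.inr hx)
  have hM : M.IsDifferential := Subfield.isDifferential_closure (by
    rintro x (hx | hx)
    · exact hM₀M _ (hM₀ x hx)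
    · rw [show x′ = 0 from hx]
      exact zero_mem _)
  have hθM : Transcendental M θ :=
    Subfield.transcendental_closure_union_constants hk hkC hθ.fieldRange
  set A : Fin t → K := fun j => algebraMap F K (α j) with hA
  have hAinj : Function.Injective A := (algebraMap F K).injective.comp hα
  have hAM : ∀ j, A j ∈ M := fun j => hM₀M _ ⟨α j, rfl⟩
  have hdata : ∀ j k, ∃ φ : K, j < k →
      φ′ = (θ - A k)′ / (θ - A k) - (A j - A k)′ / (A j - A k) ∧
        (dilog j k)′ = ((θ - A j)′ / (θ - A j) - (θ - A k)′ / (θ - A k)) * φ := fun j k => by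
    by_cases hjk : j < k
    · obtain ⟨φ, hφ⟩ := (hdilog j k hjk).exists_of_div (hlogθ j).1 (hlogθ k).1
        (sub_ne_zero.2 (hAinj.ne hjk.ne)) (sub_sub_sub_cancel_left _ _ _)
      exact ⟨φ, fun _ => hφ⟩
    · exact ⟨0, fun h => absurd h hjk⟩
  choose φ hφ using hdata
  -- The logarithm of `A j - A k` dictated by the chosen `φ`; it differs from `logα j k` by a
  -- constant. The default 0 only occurs where the coefficient is 0.
  set L : Fin t → Fin t → K := fun j k => if j < k then logθ k - φ j k else 0 with hL
  have hL' : ∀ j k, j < k → (L j k)′ = (A j - A k)′ / (A j - A k) := fun j k hjk => by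
    rw [hL]
    simp only [if_pos hjk]
    rw [map_sub, (hφ j k hjk).1, (hlogθ k).2]
    ring
  set Z : Set K := Set.range (fun p : Fin t × Fin t => L p.1 p.2) ∪
    (fun p : Fin t × Fin t => logα p.1 p.2) '' {p | p.1 ≠ p.2} with hZdef
  have hlogd : ∀ j k, (A j - A k)′ / (A j - A k) ∈ M := fun j k =>
    div_mem (hM _ (sub_mem (hAM j) (hAM k))) (sub_mem (hAM j) (hAM k))
  have hZM : ∀ z ∈ Z, z′ ∈ M := by
    rintro _ (⟨⟨j, k⟩, rfl⟩ | ⟨⟨j, k⟩, hjk, rfl⟩)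
    · by_cases hjk : j < k
      · simp only [hL' j k hjk]
        exact hlogd j k
      · simp [hL, hjk]
    · change (logα j k)′ ∈ M
      rw [(hlogα j k hjk).2, map_sub (algebraMap F K)]
      exact hlogd j k
  set E := Subfield.closure (M ∪ {θ} ∪ Z ∪ Set.range logθ : Set K) with hEdef
  have hME : ∀ x ∈ M, x ∈ E := fun x hx =>
    Subfield.subset_closure (Or.inl (Or.inl (Or.inl hx)))
  have hθE : θ ∈ E := Subfield.subset_closure (Or.inl (Or.inl (Or.inr rfl)))
  have hZE : ∀ x ∈ Z, x ∈ E := fun x hx => Subfield.subset_closure (Or.inl (Or.inr hx))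
  have hlE : ∀ j, logθ j ∈ E := fun j => Subfield.subset_closure (Or.inr ⟨j, rfl⟩)
  have hθ'E : θ′ ∈ E := by
    rcases hderiv with h | h
    · exact hME _ (hM₀M _ h)
    · have := mul_mem (hME _ (hM₀M _ h)) hθE
      rwa [div_mul_cancel₀ _ hθ0] at this
  have hl'E : ∀ j, (θ - A j)′ / (θ - A j) ∈ E := fun j =>
    div_mem (by rw [map_sub]; exact sub_mem hθ'E (hME _ (hM _ (hAM j))))
      (sub_mem hθE (hME _ (hAM j)))
  have hEd : E.IsDifferential := Subfield.isDifferential_closure (by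
    rintro x (((hx | rfl) | hx) | ⟨j, rfl⟩)
    · exact hME _ (hM x hx)
    · exact hθ'E
    · exact hME _ (hZM x hx)
    · rw [(hlogθ j).2]; exact hl'E j)
  have hφL : ∀ j k, j < k → φ j k = logθ k - L j k := fun j k hjk => by
    simp [hL, hjk]
  have hdE : ∀ p : {p : Fin t × Fin t // p.1 < p.2}, (dilog p.1.1 p.1.2)′ ∈ E := fun p => by
    rw [(hφ _ _ p.2).2, hφL _ _ p.2]
    exact mul_mem (sub_mem (hl'E _) (hl'E _))
      (sub_mem (hlE _) (hZE _ (Or.inl ⟨p.1, rfl⟩)))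
  refine AlgebraicIndependent.of_subfield_le (S := E) ?_
    (IndepModDerivIn.algebraicIndependent hEd hdE ?_)
  · intro x hx
    refine (Subfield.closure_le (t := E)).2 ?_ hx
    rintro x (hx | (rfl | ⟨j, k, hjk, rfl⟩) | ⟨j, rfl⟩)
    · exact hME _ (hM₀M _ hx)
    · exact hθE
    · exact hZE _ (Or.inr ⟨(j, k), hjk, rfl⟩)
    · exact hlE j
  · intro c _ hc u hu hsum p
    set d : Fin t → Fin t → K := fun j k => if h : j < k then c ⟨(j, k), h⟩ else 0 with hd
    have hdlt : ∀ j k (h : j < k), d j k = c ⟨(j, k), h⟩ := fun j k h => by simp [hd, h]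
    have hdnlt : ∀ j k, ¬ j < k → d j k = 0 := fun j k h => by simp [hd, h]
    rw [← hdlt _ _ p.2]
    refine dilog_coeff_eq_zero hM hC hθM (hderiv.imp (hM₀M _) (hM₀M _)) hAinj hAM
      (fun j => (hlogθ j).2) ((Set.finite_range _).union (Set.toFinite _)) hZM
      (fun j k => Or.inl ⟨(j, k), rfl⟩) (fun j k => ?_) (fun j k => ?_) (fun j k h => ?_) hu ?_ _ _
    · by_cases h : j < k
      · rw [hdlt j k h, hc]
      · rw [hdnlt j k h, map_zero]
    · by_cases h : j < k
      · exact Or.inr (hdnlt k j h.not_gt)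
      · exact Or.inl (hdnlt j k h)
    · exact hL' j k (by_contra fun h' => h (hdnlt j k h'))
    · rw [← hsum, ← Fintype.sum_prod_type', ← Fintype.sum_subtype_add_sum_subtype
        (fun p : Fin t × Fin t => p.1 < p.2)]
      rw [Finset.sum_eq_zero (s := (Finset.univ : Finset {p : Fin t × Fin t // ¬ p.1 < p.2}))
        (fun p _ => by rw [hdnlt _ _ p.2, zero_mul]), add_zero]
      refine Finset.sum_congr rfl fun p _ => ?_
      rw [hdlt _ _ p.2, (hφ _ _ p.2).2, hφL _ _ p.2, (hlogθ _).2, (hlogθ _).2]
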